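/- Let $N$ be a free $\mathbb{Z}$-module of finite rank, $N_{\mathbb R}=\mathbb R\otimes_{\mathbb Z} N$, and let $\Delta$ be a fan in $N$: a non-empty, possibly infinite, set of strongly convex rational polyhedral cones in $N_{\mathbb R}$ that contains every face of each of its members and in which the intersection of any two members is a face of both. For $\sigma\in\Delta$ let $M_\sigma$ be the commutative monoid of the linear forms $N\to\mathbb Z$ that are non-negative on $\sigma$; for $\tau\subseteq\sigma$ there is the inclusion $M_\sigma\to M_\tau$. Conventions. Affine schemes over $\mathbb F_1$ (resp. $\mathbb N$, $\mathbb Z$) are the objects of the opposite of the category of commutative monoids (resp. commutative semirings, commutative rings); the $A$-modules are the sets with an action of the monoid $A$ (resp. the semimodules, the modules over $A$). A morphism $\operatorname{Spec}B\to\operatorname{Spec}A$ is a Zariski open if $-\otimes_A B$ preserves finite limits of modules, $A\to B$ is an epimorphism, and $\operatorname{Hom}_A(B,-)$ commutes with filtered colimits of commutative $A$-algebras. A family of Zariski opens $\operatorname{Spec}B_i\to \operatorname{Spec}A$ is a Zariski covering if for some finite subfamily the functors $-\otimes_A B_i$ are jointly conservative; this generates the Zariski topology. A morphism of Zariski sheaves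 $F\to G$ is a Zariski open immersion if it is a monomorphism and, for every affine $X$ and every $X\to G$, the subsheaf $F\times_G X$ of $X$ is the image of $\coprod_i X_i\to X$ for some family of Zariski opens $X_i\to X$. A family of Zariski open immersions $X_i\to F$ with $X_i$ affine is an affine Zariski covering of the sheaf $F$ if $\coprod_i X_i\to F$ is an epimorphism of sheaves; a scheme (over $\mathbb F_1$, $\mathbb N$, $\mathbb Z$) is a sheaf that has an affine Zariski covering. The base change $-\otimes_{\mathbb F_1}\mathbb N$ (resp. $-\otimes_{\mathbb N}\mathbb Z$) sends a sheaf $F$ to the Zariski sheaf associated with $S\mapsto F(S,\cdot)$ (resp. $R\mapsto F(R)$, the ring $R$ being viewed as a semiring), and $-\otimes_{\mathbb F_1}\mathbb Z$ is their composite. Put $U_\sigma=\operatorname{Spec}M_\sigma$ and consider the Zariski sheaves over $\mathbb F_1$ $$X=\coprod_{\sigma\in\Delta}U_\sigma,\qquad R=\coprod_{\sigma,\sigma'\in\Delta}U_{\sigma\cap\sigma'},$$ with the two projections $R\rightrightarrows X$ induced by $U_{\sigma\cap\sigma'}\to U_\sigma$ and $U_{\sigma\cap\sigma'}\to U_{\sigma'}$.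 Then: 1. for every face $\tau$ of a cone $\sigma\in\Delta$, the morphism $U_\tau\to U_\sigma$ is a Zariski open; 2. $R\to X\times X$ is a monomorphism and an equivalence relation on $X$; with $X_{\mathbb F_1}(\Delta):=X/R$ (the quotient sheaf), one has $U_\sigma\times_{X_{\mathbb F_1}(\Delta)}U_{\sigma'}=U_{\sigma\cap\sigma'}$ for all $\sigma,\sigma'\in\Delta$; 3. the $U_\sigma\to X_{\mathbb F_1}(\Delta)$, $\sigma\in\Delta$, form an affine Zariski covering, so that $X_{\mathbb F_1}(\Delta)$ is an $\mathbb F_1$-scheme; 4. $X_{\mathbb F_1}(\Delta)\otimes_{\mathbb F_1}\mathbb Z$ is a $\mathbb Z$-scheme, and it is isomorphic to the functor of points $R\mapsto \operatorname{Hom}(\operatorname{Spec}R, X_{\mathbb Z}(\Delta))$ of the usual toric scheme $X_{\mathbb Z}(\Delta)$, the scheme glued from the $\operatorname{Spec}\mathbb Z[M_\sigma]$, $\sigma\in\Delta$, along the open subschemes $\operatorname{Spec}\mathbb Z[M_{\sigma\cap\sigma'}]$: $$X_{\mathbb F_1}(\Delta)\otimes_{\mathbb F_1}\mathbb Z\;\simeq\;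 X_{\mathbb Z}(\Delta).$$ -/

import Mathlib

open CategoryTheory CategoryTheory.Limits Opposite TensorProduct

universe u

noncomputable section

namespace F1Toric

section Fans

variable {N : Type u} [AddCommGroup N]

variable (N) in
/-- The real vector space `N_ℝ = ℝ ⊗ N` spanned by the lattice `N`. -/
abbrev RealSpan : Type u := ℝ ⊗[ℤ] N

/-- The real-linear extension `N_ℝ → ℝ` of a linear form `m : N → ℤ`. -/
def realForm (m : Module.Dual ℤ N) : RealSpan N →ₗ[ℝ] ℝ :=
  Module.Dual.baseChange ℝ m

@[simp] lemma realForm_tmul (m : Module.Dual ℤ N) (r : ℝ) (n : N) :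
    realForm m (r ⊗ₜ n) = (m n : ℝ) * r := by
  simp [realForm]

/-- `σ` is a rational polyhedral cone: it is spanned over `ℝ≥0` by finitely many
lattice vectors. -/
def IsRationalPolyhedral (σ : PointedCone ℝ (RealSpan N)) : Prop :=
  ∃ S : Finset N, σ = PointedCone.hull ℝ ((fun n : N => (1 : ℝ) ⊗ₜ[ℤ] n) '' (S : Set N))

/-- `σ` is strongly convex: `σ ∩ (-σ) = 0`. -/
def IsStronglyConvex (σ : PointedCone ℝ (RealSpan N)) : Prop :=
  ∀ x ∈ σ, -x ∈ σ → x = 0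

/-- `τ` is a face of `σ`: `τ = σ ∩ {y | ⟨m₀, y⟩ = 0}` for a real linear form `m₀` that is
nonnegative on `σ`. -/
def IsFace (τ σ : PointedCone ℝ (RealSpan N)) : Prop :=
  ∃ m₀ : RealSpan N →ₗ[ℝ] ℝ, (∀ y ∈ σ, 0 ≤ m₀ y) ∧ ∀ y, y ∈ τ ↔ y ∈ σ ∧ m₀ y = 0

variable (N) in
/-- A (possibly infinite) fan in the lattice `N`. -/
structure Fan where
  /-- the cones of the fan -/
  cones : Set (PointedCone ℝ (RealSpan N))
  nonempty : cones.Nonempty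
  rational : ∀ σ ∈ cones, IsRationalPolyhedral σ
  stronglyConvex : ∀ σ ∈ cones, IsStronglyConvex σ
  face_mem : ∀ σ ∈ cones, ∀ τ, IsFace τ σ → τ ∈ cones
  inf_isFace_left : ∀ σ ∈ cones, ∀ σ' ∈ cones, IsFace (σ ⊓ σ') σ
  inf_isFace_right : ∀ σ ∈ cones, ∀ σ' ∈ cones, IsFace (σ ⊓ σ') σ'

/-- The integral points of the dual cone: linear forms `N → ℤ` that are nonnegative on `σ`. -/
def dualMonoid (σ : PointedCone ℝ (RealSpan N)) : AddSubmonoid (Module.Dual ℤ N) where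
  carrier := {m | ∀ y ∈ σ, 0 ≤ realForm m y}
  zero_mem' := by
    intro y _
    simp [realForm]
  add_mem' := by
    intro a b ha hb y hy
    have : realForm (a + b) y = realForm a y + realForm b y := by
      simp [realForm]
    rw [this]
    exact add_nonneg (ha y hy) (hb y hy)

lemma mem_dualMonoid {σ : PointedCone ℝ (RealSpan N)} {m : Module.Dual ℤ N} :
    m ∈ dualMonoid σ ↔ ∀ y ∈ σ, 0 ≤ realForm m y := Iff.rfl

lemma dualMonoid_anti {τ σ : PointedCone ℝ (RealSpan N)} (h : τ ≤ σ) :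
    dualMonoid σ ≤ dualMonoid τ := fun _ hm y hy => hm y (h hy)

/-- The commutative monoid `M_σ` (written multiplicatively). -/
def coneMonoid (σ : PointedCone ℝ (RealSpan N)) : CommMonCat.{u} :=
  CommMonCat.of (Multiplicative (dualMonoid σ))

/-- For `τ ⊆ σ`, the inclusion of monoids `M_σ ⟶ M_τ`. -/
def coneMonoidMap {τ σ : PointedCone ℝ (RealSpan N)} (h : τ ≤ σ) :
    coneMonoid σ ⟶ coneMonoid τ :=
  CommMonCat.ofHom (AddMonoidHom.toMultiplicative (AddSubmonoid.inclusion (dualMonoid_anti h)))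

/-- The element of `M_σ` given by a linear form that is nonnegative on `σ`. -/
def toConeMonoid {σ : PointedCone ℝ (RealSpan N)} {m : Module.Dual ℤ N}
    (hm : m ∈ dualMonoid σ) : coneMonoid σ :=
  Multiplicative.ofAdd (⟨m, hm⟩ : dualMonoid σ)

lemma mem_dualMonoid_hull {S : Set N} {m : Module.Dual ℤ N} :
    m ∈ dualMonoid (PointedCone.hull ℝ ((fun n : N => (1 : ℝ) ⊗ₜ[ℤ] n) '' S)) ↔
      ∀ n ∈ S, 0 ≤ m n := by
  constructor
  · intro h n hn
    have := h _ (PointedCone.subset_hull ⟨n, hn, rfl⟩)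
    simpa using this
  · intro h y hy
    induction hy using Submodule.span_induction with
    | mem x hx =>
      obtain ⟨n, hn, rfl⟩ := hx
      simpa using h n hn
    | zero => simp
    | add x y _ _ hx hy => rw [map_add]; exact add_nonneg hx hy
    | smul a x _ hx =>
      have : realForm m (a • x) = (a : ℝ) * realForm m x := by
        rw [← smul_eq_mul, ← map_smul]; rfl
      rw [this]
      exact mul_nonneg a.2 hx

/-- Approximation of a real linear form by an integral one, keeping signs on a finite set. -/
lemma exists_integral_form [Module.Free ℤ N] [Module.Finite ℤ N] (S : Finset N)
    (u : N →ₗ[ℤ] ℝ) (hu : ∀ n ∈ S, 0 ≤ u n) :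
    ∃ m : Module.Dual ℤ N, ∀ n ∈ S, 0 ≤ m n ∧ (m n = 0 ↔ u n = 0) := by
  classical
  let H := LinearMap.range u
  have : Module.Free ℤ H := inferInstance
  let ι := Module.Free.ChooseBasisIndex ℤ H
  let e : Module.Basis ι ℤ H := Module.Free.chooseBasis ℤ H
  let c : N → ι → ℤ := fun n j => e.repr (u.rangeRestrict n) j
  have hc : ∀ n, u n = ∑ j, (c n j : ℝ) * (e j : ℝ) := by
    intro n
    have h1 := congrArg (fun h : H => (h : ℝ)) (e.sum_repr (u.rangeRestrict n))
    simp only [Submodule.coe_sum, Submodule.coe_smul, zsmul_eq_mul] at h1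
    exact h1.symm
  let U : Set (ι → ℝ) := ⋂ n ∈ S.filter (fun n => 0 < u n), {q | 0 < ∑ j, (c n j : ℝ) * q j}
  have hUo : IsOpen U := by
    refine isOpen_biInter_finset fun n _ => ?_
    exact isOpen_lt continuous_const (by fun_prop)
  have hUe : (fun j => (e j : ℝ)) ∈ U := by
    simp only [U, Set.mem_iInter, Finset.mem_filter, Set.mem_ofPred_eq]
    rintro n ⟨_, hn⟩
    rwa [← hc n]
  have hd : DenseRange (Pi.map (fun (_ : ι) (q : ℚ) => (q : ℝ))) :=
    DenseRange.piMap fun _ => Rat.denseRange_cast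
  obtain ⟨q, hq⟩ := hd.exists_mem_open hUo ⟨_, hUe⟩
  simp only [U, Set.mem_iInter, Finset.mem_filter, Set.mem_ofPred_eq, Pi.map_apply] at hq
  let D : ℕ := ∏ j, (q j).den
  have hD : 0 < D := Finset.prod_pos fun j _ => (q j).den_pos
  have hz : ∀ j, ∃ z : ℤ, (z : ℝ) = (D : ℝ) * (q j : ℝ) := by
    intro j
    obtain ⟨d, hd'⟩ : (q j).den ∣ D := Finset.dvd_prod_of_mem _ (Finset.mem_univ j)
    refine ⟨d * (q j).num, ?_⟩
    have : ((q j).den : ℝ) * (q j : ℝ) = (q j).num := by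
      exact_mod_cast Rat.den_mul_eq_num (q j)
    rw [hd']
    push_cast
    rw [← this]; ring
  choose z hz using hz
  let m : Module.Dual ℤ N := (e.constr ℤ z).comp u.rangeRestrict
  have hm : ∀ n, m n = ∑ j, c n j * z j := by
    intro n
    simp [m, c, Module.Basis.constr_apply_fintype, Module.Basis.equivFun_apply]
  refine ⟨m, fun n hn => ?_⟩
  rcases (hu n hn).eq_or_lt with h0 | hpos
  · have : m n = 0 := by
      have : u.rangeRestrict n = 0 := Subtype.ext h0.symm
      simp [m, this]
    simp [this, h0.symm]
  · have h1 := hq n ⟨hn, hpos⟩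
    have h2 : (0 : ℝ) < (m n : ℝ) := by
      have : (m n : ℝ) = D * ∑ j, (c n j : ℝ) * (q j : ℝ) := by
        rw [hm, Finset.mul_sum]
        push_cast
        refine Finset.sum_congr rfl fun j _ => ?_
        rw [hz]; ring
      rw [this]
      exact mul_pos (by exact_mod_cast hD) h1
    have h3 : 0 < m n := by exact_mod_cast h2
    exact ⟨h3.le, by constructor <;> intro h <;> linarith⟩

/-- `m ∈ M_σ` cuts out `τ` in `σ`. -/
def CutsOut (m : Module.Dual ℤ N) (τ σ : PointedCone ℝ (RealSpan N)) : Prop :=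
  m ∈ dualMonoid σ ∧ ∀ y, y ∈ τ ↔ y ∈ σ ∧ realForm m y = 0

lemma realForm_add (a b : Module.Dual ℤ N) (y : RealSpan N) :
    realForm (a + b) y = realForm a y + realForm b y := by simp [realForm]

lemma CutsOut.inf {m₁ m₂ : Module.Dual ℤ N} {τ₁ τ₂ σ : PointedCone ℝ (RealSpan N)}
    (h₁ : CutsOut m₁ τ₁ σ) (h₂ : CutsOut m₂ τ₂ σ) : CutsOut (m₁ + m₂) (τ₁ ⊓ τ₂) σ := by
  refine ⟨add_mem h₁.1 h₂.1, fun y => ?_⟩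
  rw [Submodule.mem_inf, h₁.2, h₂.2, realForm_add]
  constructor
  · rintro ⟨⟨hy, ha⟩, -, hb⟩
    exact ⟨hy, by rw [ha, hb, add_zero]⟩
  · rintro ⟨hy, hab⟩
    have ha := h₁.1 y hy
    have hb := h₂.1 y hy
    exact ⟨⟨hy, by linarith⟩, hy, by linarith⟩

lemma form_le_of_hull {S : Set N} {f g : RealSpan N →ₗ[ℝ] ℝ} 
    (h : ∀ n ∈ S, f (1 ⊗ₜ n) ≤ g (1 ⊗ₜ n)) :
    ∀ y ∈ PointedCone.hull ℝ ((fun n : N => (1 : ℝ) ⊗ₜ[ℤ] n) '' S), f y ≤ g y := by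
  intro y hy
  induction hy using Submodule.span_induction with
  | mem x hx => obtain ⟨n, hn, rfl⟩ := hx; exact h n hn
  | zero => simp
  | add x y _ _ hx hy => rw [map_add, map_add]; exact add_le_add hx hy
  | smul a x _ hx =>
    have hl : ∀ l : RealSpan N →ₗ[ℝ] ℝ, l (a • x) = (a : ℝ) * l x := by
      intro l; rw [← smul_eq_mul, ← map_smul]; rfl
    rw [hl, hl]
    exact mul_le_mul_of_nonneg_left hx a.2

/-- A face of a rational polyhedral cone is cut out by an integral linear form. -/
lemma exists_cutsOut [Module.Free ℤ N] [Module.Finite ℤ N]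
    {τ σ : PointedCone ℝ (RealSpan N)} (hσ : IsRationalPolyhedral σ) (h : IsFace τ σ) :
    ∃ m, CutsOut m τ σ := by
  classical
  obtain ⟨S, rfl⟩ := hσ
  obtain ⟨m₀, hm₀, hτ⟩ := h
  have hS : ∀ n ∈ S, (1 : ℝ) ⊗ₜ[ℤ] n ∈
      PointedCone.hull ℝ ((fun n : N => (1 : ℝ) ⊗ₜ[ℤ] n) '' (S : Set N)) :=
    fun n hn => PointedCone.subset_hull ⟨n, hn, rfl⟩
  let u : N →ₗ[ℤ] ℝ := (m₀.restrictScalars ℤ).comp (TensorProduct.mk ℤ ℝ N 1)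
  have hu : ∀ n, u n = m₀ (1 ⊗ₜ n) := fun _ => rfl
  obtain ⟨m, hm⟩ := exists_integral_form S u (fun n hn => hm₀ _ (hS n hn))
  have hmσ := (mem_dualMonoid_hull (S := (S : Set N)) (m := m)).2 fun n hn => (hm n hn).1
  refine ⟨m, hmσ, fun y => ?_⟩
  rw [hτ]
  refine and_congr_right fun hy => ?_
  have key : ∀ f g : N → ℝ, (∀ n ∈ S, 0 ≤ f n) → (∀ n ∈ S, 0 ≤ g n) →
      (∀ n ∈ S, g n = 0 → f n = 0) → ∃ C : ℝ, ∀ n ∈ S, f n ≤ C * g n := by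
    intro f g hf hg hfg
    refine ⟨∑ n ∈ S, f n / g n, fun n hn => ?_⟩
    rcases (hg n hn).eq_or_lt with h0 | hpos
    · rw [hfg n hn h0.symm, ← h0, mul_zero]
    · rw [← div_le_iff₀ hpos]
      exact Finset.single_le_sum (f := fun n => f n / g n)
        (fun i hi => div_nonneg (hf i hi) (hg i hi)) hn
  have hmn : ∀ n ∈ S, (0 : ℝ) ≤ m n := fun n hn => by exact_mod_cast (hm n hn).1
  have hun : ∀ n ∈ S, 0 ≤ u n := fun n hn => hm₀ _ (hS n hn)
  obtain ⟨C, hC⟩ := key (fun n => (m n : ℝ)) u hmn hun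
    (fun n hn h => by exact_mod_cast (hm n hn).2.2 h)
  obtain ⟨C', hC'⟩ := key u (fun n => (m n : ℝ)) hun hmn
    (fun n hn h => (hm n hn).2.1 (by exact_mod_cast h))
  have h1 : realForm m y ≤ (C • m₀) y :=
    form_le_of_hull (S := (S : Set N)) (fun n hn => by simpa [hu] using hC n hn) y hy
  have h2 : m₀ y ≤ (C' • realForm m) y :=
    form_le_of_hull (S := (S : Set N)) (fun n hn => by simpa [hu] using hC' n hn) y hy
  have h3 := hm₀ y hy
  have h4 := hmσ y hy
  simp only [LinearMap.smul_apply, smul_eq_mul] at h1 h2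
  constructor
  · intro h; rw [h] at h1; linarith
  · intro h; rw [h] at h2; linarith

/-- If `m` cuts out `τ` in `σ` then `M_τ = M_σ + ℕ (-m)`. -/
lemma CutsOut.exists_add_mem {m : Module.Dual ℤ N} {τ σ : PointedCone ℝ (RealSpan N)}
    (hσ : IsRationalPolyhedral σ) (h : CutsOut m τ σ) {a : Module.Dual ℤ N}
    (ha : a ∈ dualMonoid τ) : ∃ k : ℕ, a + k • m ∈ dualMonoid σ := by
  classical
  obtain ⟨S, rfl⟩ := hσ
  refine ⟨∑ n ∈ S, (a n).natAbs, ?_⟩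
  refine mem_dualMonoid_hull.2 fun n hn => ?_
  have hmn : 0 ≤ m n := mem_dualMonoid_hull.1 h.1 n hn
  have hle : (a n).natAbs ≤ ∑ n ∈ S, (a n).natAbs :=
    Finset.single_le_sum (f := fun n => (a n).natAbs) (fun _ _ => Nat.zero_le _) hn
  simp only [LinearMap.add_apply, LinearMap.smul_apply, nsmul_eq_mul]
  rcases hmn.eq_or_lt with h0 | hpos
  · have : (1 : ℝ) ⊗ₜ[ℤ] n ∈ τ :=
      (h.2 _).2 ⟨PointedCone.subset_hull ⟨n, hn, rfl⟩, by simp [← h0]⟩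
    have := ha _ this
    rw [← h0, mul_zero, add_zero]
    simpa using this
  · have h1 : ((a n).natAbs : ℤ) ≤ ((∑ n ∈ S, (a n).natAbs : ℕ) : ℤ) := by exact_mod_cast hle
    have h2 : -((a n).natAbs : ℤ) ≤ a n := by omega
    nlinarith

lemma CutsOut.neg_mem {m : Module.Dual ℤ N} {τ σ : PointedCone ℝ (RealSpan N)}
    (h : CutsOut m τ σ) : -m ∈ dualMonoid τ := by
  intro y hy
  have : realForm (-m) y = - realForm m y := by simp [realForm]
  rw [this, ((h.2 y).1 hy).2, neg_zero]

lemma IsFace.le {τ σ : PointedCone ℝ (RealSpan N)} (h : IsFace τ σ) : τ ≤ σ := by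
  obtain ⟨m, _, hm⟩ := h
  exact fun y hy => ((hm y).1 hy).1

lemma CutsOut.le {m : Module.Dual ℤ N} {τ σ : PointedCone ℝ (RealSpan N)}
    (h : CutsOut m τ σ) : τ ≤ σ := fun y hy => ((h.2 y).1 hy).1

end Fans
section ToricScheme

open AlgebraicGeometry

section MonoidLocalization

variable {M M' : Type u} [CommMonoid M] [CommMonoid M']

/-- If `φ : M → M'` is the localization of monoids inverting `m` (and is injective), then
`ℤ[M] → ℤ[M']` is the localization at `χ^m`. -/
lemma isLocalization_monoidAlgebra (φ : M →* M') (hφ : Function.Injective φ) (m : M)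
    (hm : IsUnit (φ m)) (hs : ∀ a : M', ∃ (k : ℕ) (b : M), a * φ m ^ k = φ b) :
    letI := (MonoidAlgebra.mapDomainRingHom ℤ φ).toAlgebra
    IsLocalization.Away (MonoidAlgebra.single m 1 : MonoidAlgebra ℤ M) (MonoidAlgebra ℤ M') := by
  classical
  let := (MonoidAlgebra.mapDomainRingHom ℤ φ).toAlgebra
  have hmap : ∀ x, algebraMap (MonoidAlgebra ℤ M) (MonoidAlgebra ℤ M') x =
      MonoidAlgebra.mapDomainRingHom ℤ φ x := fun _ => rfl
  have hpow : ∀ k : ℕ, (MonoidAlgebra.single m 1 : MonoidAlgebra ℤ M) ^ k =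
      MonoidAlgebra.single (m ^ k) 1 := fun k => by
    rw [MonoidAlgebra.single_pow, one_pow]
  have hinj : Function.Injective (MonoidAlgebra.mapDomainRingHom ℤ φ) :=
    MonoidAlgebra.mapDomain_injective hφ
  refine ⟨?_, ?_, ?_⟩
  · rintro ⟨_, k, rfl⟩
    dsimp only
    rw [map_pow, hmap]
    refine IsUnit.pow k ?_
    have : MonoidAlgebra.mapDomainRingHom ℤ φ (MonoidAlgebra.single m 1) =
        MonoidAlgebra.of ℤ M' (φ m) := by simp
    rw [this]
    exact hm.map _
  · intro z
    induction z using MonoidAlgebra.induction_linear with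
    | zero => exact ⟨(0, 1), by simp⟩
    | add f g hf hg =>
      obtain ⟨⟨x, s⟩, hx⟩ := hf
      obtain ⟨⟨y, t⟩, hy⟩ := hg
      refine ⟨(x * t + y * s, s * t), ?_⟩
      dsimp only at hx hy ⊢
      rw [map_add, map_mul, map_mul, ← hx, ← hy, Submonoid.coe_mul, map_mul]
      ring
    | single a r =>
      obtain ⟨k, b, hb⟩ := hs a
      refine ⟨(MonoidAlgebra.single b r, ⟨_, k, rfl⟩), ?_⟩
      dsimp only
      rw [hpow, hmap, hmap]
      simp [MonoidAlgebra.single_mul_single, hb]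
  · intro x y hxy
    exact ⟨1, by rw [hinj hxy]⟩

lemma isOpenImmersion_monoidAlgebra (φ : M →* M') (hφ : Function.Injective φ) (m : M)
    (hm : IsUnit (φ m)) (hs : ∀ a : M', ∃ (k : ℕ) (b : M), a * φ m ^ k = φ b) :
    IsOpenImmersion (Spec.map (CommRingCat.ofHom (MonoidAlgebra.mapDomainRingHom ℤ φ))) := by
  let := (MonoidAlgebra.mapDomainRingHom ℤ φ).toAlgebra
  have := isLocalization_monoidAlgebra φ hφ m hm hs
  exact IsOpenImmersion.of_isLocalization (MonoidAlgebra.single m 1 : MonoidAlgebra ℤ M)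

lemma mem_range_monoidAlgebra (φ : M →* M') (hφ : Function.Injective φ) (m : M)
    (hm : IsUnit (φ m)) (hs : ∀ a : M', ∃ (k : ℕ) (b : M), a * φ m ^ k = φ b)
    (x : PrimeSpectrum (MonoidAlgebra ℤ M)) :
    x ∈ Set.range (PrimeSpectrum.comap (MonoidAlgebra.mapDomainRingHom ℤ φ)) ↔
      (MonoidAlgebra.single m 1 : MonoidAlgebra ℤ M) ∉ x.asIdeal := by
  let := (MonoidAlgebra.mapDomainRingHom ℤ φ).toAlgebra
  have := isLocalization_monoidAlgebra φ hφ m hm hs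
  have h2 := PrimeSpectrum.localization_away_comap_range (MonoidAlgebra ℤ M')
    (MonoidAlgebra.single m 1 : MonoidAlgebra ℤ M)
  change x ∈ Set.range (PrimeSpectrum.comap
    (algebraMap (MonoidAlgebra ℤ M) (MonoidAlgebra ℤ M'))) ↔ _
  rw [h2]
  rfl

end MonoidLocalization

variable {N : Type u} [AddCommGroup N]

/-- The monoid ring `ℤ[M]` of a commutative monoid `M`. -/
def intMonoidRing : CommMonCat.{u} ⥤ CommRingCat.{u} where
  obj M := CommRingCat.of (MonoidAlgebra ℤ M)
  map f := CommRingCat.ofHom (MonoidAlgebra.mapDomainRingHom ℤ f.hom)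
  map_id M := by
    ext : 1
    exact MonoidAlgebra.mapDomainRingHom_id (R := ℤ) (M := M)
  map_comp {X Y Z} f g := by
    ext : 1
    exact MonoidAlgebra.mapDomainRingHom_comp (R := ℤ) g.hom f.hom

lemma coneMonoidMap_injective {τ σ : PointedCone ℝ (RealSpan N)} (h : τ ≤ σ) :
    Function.Injective (coneMonoidMap h).hom := fun a b hab => by
  have h1 : AddSubmonoid.inclusion (dualMonoid_anti h) (Multiplicative.toAdd a) =
    AddSubmonoid.inclusion (dualMonoid_anti h) (Multiplicative.toAdd b) := hab
  exact AddSubmonoid.inclusion_injective _ h1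

lemma CutsOut.isUnit {m : Module.Dual ℤ N} {τ σ : PointedCone ℝ (RealSpan N)}
    (h : CutsOut m τ σ) :
    IsUnit ((coneMonoidMap h.le).hom (toConeMonoid h.1)) := by
  refine IsUnit.of_mul_eq_one (toConeMonoid h.neg_mem) ?_
  change Multiplicative.ofAdd ((⟨m, _⟩ : dualMonoid τ) + ⟨-m, h.neg_mem⟩) = Multiplicative.ofAdd 0
  congr 1
  exact Subtype.ext (add_neg_cancel m)

lemma CutsOut.exists_mul_pow {m : Module.Dual ℤ N} {τ σ : PointedCone ℝ (RealSpan N)}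
    (hσ : IsRationalPolyhedral σ) (h : CutsOut m τ σ) (a : coneMonoid τ) :
    ∃ (k : ℕ) (b : coneMonoid σ),
      a * (coneMonoidMap h.le).hom (toConeMonoid h.1) ^ k =
        (coneMonoidMap h.le).hom b := by
  obtain ⟨k, hk⟩ := h.exists_add_mem hσ (Multiplicative.toAdd a).2
  refine ⟨k, Multiplicative.ofAdd ⟨_, hk⟩, ?_⟩
  change Multiplicative.ofAdd ((Multiplicative.toAdd a : dualMonoid τ) +
    k • (⟨m, dualMonoid_anti h.le h.1⟩ : dualMonoid τ)) = Multiplicative.ofAdd _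
  congr 1

lemma CutsOut.isOpenImmersion {m : Module.Dual ℤ N} {τ σ : PointedCone ℝ (RealSpan N)}
    (hσ : IsRationalPolyhedral σ) (h : CutsOut m τ σ) :
    IsOpenImmersion (Spec.map (intMonoidRing.map (coneMonoidMap h.le))) :=
  isOpenImmersion_monoidAlgebra _ (coneMonoidMap_injective h.le) _ h.isUnit
    (h.exists_mul_pow hσ)

lemma CutsOut.mem_range {m : Module.Dual ℤ N} {τ σ : PointedCone ℝ (RealSpan N)}
    (hσ : IsRationalPolyhedral σ) (h : CutsOut m τ σ)
    (x : PrimeSpectrum (MonoidAlgebra ℤ (coneMonoid σ))) :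
    x ∈ Set.range (PrimeSpectrum.comap (MonoidAlgebra.mapDomainRingHom ℤ
      (coneMonoidMap h.le).hom)) ↔
      (MonoidAlgebra.single (toConeMonoid h.1) 1 :
        MonoidAlgebra ℤ (coneMonoid σ)) ∉ x.asIdeal :=
  mem_range_monoidAlgebra _ (coneMonoidMap_injective h.le) _ h.isUnit (h.exists_mul_pow hσ) x

/-- The diagram `σ ↦ Spec ℤ[M_σ]` indexed by the cones of `Δ`, ordered by inclusion
(for cones of a fan, `τ ⊆ σ` means that `τ` is a face of `σ`). -/
def toricDiagram (Δ : Fan N) : Δ.cones ⥤ Scheme.{u} where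
  obj σ := Spec (intMonoidRing.obj (coneMonoid σ.1))
  map f := Spec.map (intMonoidRing.map (coneMonoidMap (leOfHom f)))
  map_id σ := by
    rw [← Spec.map_id, ← intMonoidRing.map_id]; rfl
  map_comp f g := by
    rw [← Spec.map_comp, ← intMonoidRing.map_comp]; rfl

variable [Module.Free ℤ N] [Module.Finite ℤ N]

lemma Fan.exists_cutsOut (Δ : Fan N) {τ σ : Δ.cones} (h : τ ≤ σ) : ∃ m, CutsOut m τ.1 σ.1 := by
  have h1 := Δ.inf_isFace_left σ.1 σ.2 τ.1 τ.2
  rw [inf_eq_right.2 (show τ.1 ≤ σ.1 from h)] at h1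
  exact F1Toric.exists_cutsOut (Δ.rational _ σ.2) h1

instance toricDiagram_isOpenImmersion (Δ : Fan N) {τ σ : Δ.cones} (f : τ ⟶ σ) :
    IsOpenImmersion ((toricDiagram Δ).map f) := by
  obtain ⟨m, hm⟩ := Δ.exists_cutsOut (leOfHom f)
  exact hm.isOpenImmersion (Δ.rational _ σ.2)

instance toricDiagram_isLocallyDirected (Δ : Fan N) :
    (toricDiagram Δ ⋙ Scheme.forget).IsLocallyDirected := by
  constructor
  intro i j k fi fj xi xj hx
  obtain ⟨mi, hi⟩ := Δ.exists_cutsOut (leOfHom fi)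
  obtain ⟨mj, hj⟩ := Δ.exists_cutsOut (leOfHom fj)
  let l : Δ.cones := ⟨i.1 ⊓ j.1, Δ.face_mem _ i.2 _ (Δ.inf_isFace_left _ i.2 _ j.2)⟩
  let fl : l ⟶ i := homOfLE (show i.1 ⊓ j.1 ≤ i.1 from inf_le_left)
  let fl' : l ⟶ j := homOfLE (show i.1 ⊓ j.1 ≤ j.1 from inf_le_right)
  have hl : CutsOut (mi + mj) l.1 k.1 := hi.inf hj
  have hk := Δ.rational _ k.2
  have h1 : (toricDiagram Δ).map fi xi ∈ Set.range ((toricDiagram Δ).map fi) := ⟨_, rfl⟩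
  have h2 : (toricDiagram Δ).map fi xi ∈ Set.range ((toricDiagram Δ).map fj) := ⟨xj, hx.symm⟩
  have h3 : (toricDiagram Δ).map fi xi ∈ Set.range ((toricDiagram Δ).map (fl ≫ fi)) := by
    have e1 := (CutsOut.mem_range hk hi _).1 h1
    have e2 := (CutsOut.mem_range hk hj _).1 h2
    refine (CutsOut.mem_range hk hl _).2 fun hmem => ?_
    have hmul : (MonoidAlgebra.single (toConeMonoid hl.1) 1 :
        MonoidAlgebra ℤ (coneMonoid k.1)) =
        MonoidAlgebra.single (toConeMonoid hi.1) 1 *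
        MonoidAlgebra.single (toConeMonoid hj.1) 1 := by
      rw [MonoidAlgebra.single_mul_single, one_mul]
      rfl
    rw [hmul] at hmem
    rcases ((show PrimeSpectrum (MonoidAlgebra ℤ (coneMonoid k.1)) from
      (toricDiagram Δ).map fi xi).2.mem_or_mem hmem) with h | h
    · exact e1 h
    · exact e2 h
  obtain ⟨x, hx3⟩ := h3
  have a1 : (toricDiagram Δ).map fl x = xi := by
    apply ((toricDiagram Δ).map fi).isOpenEmbedding.injective
    rw [← hx3, Functor.map_comp]; rfl
  have a2 : (toricDiagram Δ).map fl' x = xj := by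
    apply ((toricDiagram Δ).map fj).isOpenEmbedding.injective
    refine Eq.trans ?_ hx
    refine Eq.trans ?_ hx3
    rw [← Scheme.Hom.comp_apply, ← Functor.map_comp]
    rfl
  exact ⟨l, fl, fl', x, a1, a2⟩

/-- The usual toric scheme `X_ℤ(Δ)`, obtained by gluing the affine schemes `Spec ℤ[M_σ]` along
the open immersions `Spec ℤ[M_τ] → Spec ℤ[M_σ]` given by the faces `τ` of `σ`; in particular
the charts of `σ` and `σ'` are glued along `Spec ℤ[M_{σ ∩ σ'}]`. -/
def toricScheme (Δ : Fan N) : Scheme.{u} := colimit (toricDiagram Δ)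

end ToricScheme
section ASets

variable {A B : CommMonCat.{u}} (φ : A ⟶ B)

/-- The relation `(b φ(a), x) ∼ (b, a x)` on `B × X` defining `B ⊗_A X`. -/
def ASetTensorRel (X : Action (Type u) A) (p q : B × X.V) : Prop :=
  ∃ (b : B) (a : A) (x : X.V), p = (b * φ.hom a, x) ∧ q = (b, X.ρ a x)

/-- The set `B ⊗_A X`. -/
def ASetTensor (X : Action (Type u) A) : Type u := Quot (ASetTensorRel φ X)

/-- The class `b ⊗ x`. -/
def ASetTensor.mk {X : Action (Type u) A} (b : B) (x : X.V) : ASetTensor φ X :=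
  Quot.mk _ (b, x)

lemma ASetTensor.mk_mul {X : Action (Type u) A} (b : B) (a : A) (x : X.V) :
    ASetTensor.mk φ (b * φ.hom a) x = ASetTensor.mk φ b (X.ρ a x) :=
  Quot.sound ⟨b, a, x, rfl, rfl⟩

/-- The action of `c : B` on `B ⊗_A X`. -/
def ASetTensor.smul {X : Action (Type u) A} (c : B) : ASetTensor φ X → ASetTensor φ X :=
  Quot.lift (fun p => ASetTensor.mk φ (c * p.1) p.2) (by
    rintro _ _ ⟨b, a, x, rfl, rfl⟩
    dsimp only
    rw [← mul_assoc, ASetTensor.mk_mul])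

/-- The functoriality of `B ⊗_A X` in `X`. -/
def ASetTensor.map {X Y : Action (Type u) A} (f : X ⟶ Y) : ASetTensor φ X → ASetTensor φ Y :=
  Quot.lift (fun p => ASetTensor.mk φ p.1 (f.hom p.2)) (by
    rintro _ _ ⟨b, a, x, rfl, rfl⟩
    dsimp only
    rw [ASetTensor.mk_mul]
    congr 1
    exact (ConcreteCategory.congr_hom (f.comm a) x).symm)

/-- Extension of scalars `B ⊗_A -` from `A`-sets to `B`-sets. -/
def aSetExtend : Action (Type u) A ⥤ Action (Type u) B where
  obj X :=
    { V := ASetTensor φ X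
      ρ :=
        { toFun := fun c => TypeCat.ofHom (ASetTensor.smul φ c)
          map_one' := by
            refine ConcreteCategory.hom_ext (C := Type u) _ _ ?_
            rintro ⟨b, x⟩
            change ASetTensor.mk φ (1 * b) x = ASetTensor.mk φ b x
            rw [one_mul]
          map_mul' := by
            intro c d
            refine ConcreteCategory.hom_ext (C := Type u) _ _ ?_
            rintro ⟨b, x⟩
            change ASetTensor.mk φ (c * d * b) x = ASetTensor.mk φ (c * (d * b)) x
            rw [mul_assoc] } }
  map f :=
    { hom := TypeCat.ofHom (ASetTensor.map φ f)
      comm := by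
        intro c
        ext ⟨b, x⟩
        rfl }
  map_id X := by
    ext ⟨b, x⟩
    rfl
  map_comp f g := by
    ext ⟨b, x⟩
    rfl

/-- Extension of scalars is left adjoint to restriction. -/
def aSetAdj : aSetExtend φ ⊣ Action.res (Type u) φ.hom :=
  Adjunction.mkOfHomEquiv
    { homEquiv := fun X Y =>
        { toFun := fun f =>
            { hom := TypeCat.ofHom fun x => f.hom (ASetTensor.mk φ 1 x)
              comm := by
                intro a
                ext x
                have h := ConcreteCategory.congr_hom (f.comm (φ.hom a)) (ASetTensor.mk φ 1 x)
                change f.hom (ASetTensor.mk φ 1 (X.ρ a x)) = _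
                rw [← ASetTensor.mk_mul, one_mul]
                refine Eq.trans ?_ h
                change _ = f.hom (ASetTensor.mk φ (φ.hom a * 1) x)
                rw [mul_one] }
          invFun := fun g =>
            { hom := TypeCat.ofHom (Quot.lift (fun p => Y.ρ p.1 (g.hom p.2)) (by
                rintro _ _ ⟨b, a, x, rfl, rfl⟩
                have h := ConcreteCategory.congr_hom (g.comm a) x
                dsimp only
                rw [map_mul]
                exact congrArg (Y.ρ b) h.symm))
              comm := by
                intro c
                ext ⟨b, x⟩
                change Y.ρ (c * b) (g.hom x) = _
                rw [map_mul]
                rfl }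
          left_inv := by
            intro f
            ext ⟨b, x⟩
            have h := ConcreteCategory.congr_hom (f.comm b) (ASetTensor.mk φ 1 x)
            refine Eq.trans h.symm ?_
            change f.hom (ASetTensor.mk φ (b * 1) x) = f.hom (ASetTensor.mk φ b x)
            rw [mul_one]
          right_inv := by
            intro g
            ext x
            change Y.ρ 1 (g.hom x) = g.hom x
            rw [map_one]
            rfl }
      homEquiv_naturality_left_symm := by
        intro X X' Y f g
        ext ⟨b, x⟩
        rfl
      homEquiv_naturality_right := by
        intro X Y Y' f g
        rfl }

end ASets

section Semimodules

variable {A B : CommSemiRingCat.{u}} (φ : A ⟶ B)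

/-- Restriction of scalars for semimodules. -/
def semiRestrict : SemimoduleCat.{u} B ⥤ SemimoduleCat.{u} A where
  obj M :=
    letI := Module.compHom M φ.hom
    SemimoduleCat.of A M
  map {M M'} f :=
    letI := Module.compHom M φ.hom
    letI := Module.compHom M' φ.hom
    SemimoduleCat.ofHom
      { toFun := f.hom
        map_add' := map_add f.hom
        map_smul' := fun a x => map_smul f.hom (φ.hom a) x }

/-- Extension of scalars `B ⊗_A -` for semimodules. -/
def semiExtend : SemimoduleCat.{u} A ⥤ SemimoduleCat.{u} B where
  obj M :=
    letI := φ.hom.toAlgebra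
    SemimoduleCat.of B (B ⊗[A] M)
  map f :=
    letI := φ.hom.toAlgebra
    SemimoduleCat.ofHom (f.hom.baseChange B)
  map_id M := by
    let := φ.hom.toAlgebra
    ext : 1
    exact LinearMap.baseChange_id
  map_comp f g := by
    let := φ.hom.toAlgebra
    ext : 1
    exact LinearMap.baseChange_comp _ _

/-- Unbundled form of the adjunction. -/
def semiHomEquiv (X : SemimoduleCat.{u} A) (Y : SemimoduleCat.{u} B) :
    ((semiExtend φ).obj X ⟶ Y) ≃ (X ⟶ (semiRestrict φ).obj Y) :=
  letI := φ.hom.toAlgebra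
  letI : Module A Y := Module.compHom Y φ.hom
  haveI : IsScalarTower A B Y := ⟨fun a b y => by
    rw [Algebra.smul_def, mul_smul]; rfl⟩
  SemimoduleCat.homEquiv.trans
    ((LinearMap.liftBaseChangeEquiv (R := A) (M := X) (N := Y) B).symm.toEquiv.trans
      (SemimoduleCat.homEquiv (M := X) (N := SemimoduleCat.of A Y)).symm)

/-- Extension of scalars is left adjoint to restriction. -/
def semiAdj : semiExtend φ ⊣ semiRestrict φ :=
  Adjunction.mkOfHomEquiv
    { homEquiv := semiHomEquiv φ
      homEquiv_naturality_left_symm := by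
        intro X X' Y f g
        let := φ.hom.toAlgebra
        let : Module A Y := Module.compHom Y φ.hom
        have : IsScalarTower A B Y := ⟨fun a b y => by
          rw [Algebra.smul_def, mul_smul]; rfl⟩
        ext : 1
        refine TensorProduct.AlgebraTensorModule.ext fun b x => ?_
        rfl
      homEquiv_naturality_right := by
        intro X Y Y' f g
        rfl }

end Semimodules

section RelativeGeometry

/-- The input of relative geometry over a symmetric monoidal category `𝓔`: the category
`C = Comm(𝓔)` of commutative monoids of `𝓔` and, for every `A : C`, the category of
`A`-modules, with extension and restriction of scalars. -/
structure ModuleTheory (C : Type (u + 1)) [LargeCategory.{u} C] where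
  /-- the category of `A`-modules -/
  Mod : C → Type (u + 1)
  /-- its category structure -/
  [cat : ∀ A, LargeCategory.{u} (Mod A)]
  /-- extension of scalars `- ⊗_A B` -/
  extend : ∀ {A B : C}, (A ⟶ B) → (Mod A ⥤ Mod B)
  /-- restriction of scalars -/
  restrict : ∀ {A B : C}, (A ⟶ B) → (Mod B ⥤ Mod A)
  /-- extension is left adjoint to restriction -/
  adj : ∀ {A B : C} (φ : A ⟶ B), extend φ ⊣ restrict φ

attribute [instance] ModuleTheory.cat

/-- Relative geometry over `(Set, ×, *)`: commutative monoids `A` and `A`-sets. -/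
def overF1 : ModuleTheory CommMonCat.{u} where
  Mod A := Action (Type u) A
  extend φ := aSetExtend φ
  restrict φ := Action.res (Type u) φ.hom
  adj φ := aSetAdj φ

/-- Relative geometry over `(ℕ-Mod, ⊗, ℕ)`: commutative semirings and their semimodules. -/
def overN : ModuleTheory CommSemiRingCat.{u} where
  Mod A := SemimoduleCat.{u} A
  extend φ := semiExtend φ
  restrict φ := semiRestrict φ
  adj φ := semiAdj φ

/-- Relative geometry over `(ℤ-Mod, ⊗, ℤ)`: commutative rings and their modules. -/
def overZ : ModuleTheory CommRingCat.{u} where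
  Mod A := ModuleCat.{u} A
  extend φ := ModuleCat.extendScalars φ.hom
  restrict φ := ModuleCat.restrictScalars φ.hom
  adj φ := ModuleCat.extendRestrictScalarsAdj φ.hom

namespace ModuleTheory

variable {C : Type (u + 1)} [LargeCategory.{u} C] (T : ModuleTheory C)

/-- `A ⟶ B` is a Zariski open (more precisely `Spec B → Spec A` is): it is flat
(`- ⊗_A B` preserves finite limits), an epimorphism, and of finite presentation
(`Hom_{A/C}(B, -)` commutes with filtered colimits). -/
structure IsZariskiOpen {A B : C} (φ : A ⟶ B) : Prop where
  flat : PreservesFiniteLimits (T.extend φ)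
  epi : Epi φ
  finitePresentation : IsFinitelyPresentable.{u} (Under.mk φ)

/-- The Zariski coverings of `Spec A`: families of Zariski opens having a finite subfamily
`Spec B_i → Spec A` for which the functors `- ⊗_A B_i` are jointly conservative. -/
def zariskiPrecoverage : Precoverage Cᵒᵖ where
  coverings X := {P | (∀ ⦃Y : Cᵒᵖ⦄ (f : Y ⟶ X), P f → T.IsZariskiOpen f.unop) ∧
    ∃ (n : ℕ) (B : Fin n → C) (φ : ∀ i, X.unop ⟶ B i), (∀ i, P (φ i).op) ∧
      ∀ ⦃M M' : T.Mod X.unop⦄ (v : M ⟶ M'), (∀ i, IsIso ((T.extend (φ i)).map v)) → IsIso v}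

/-- The Zariski topology on the category `Cᵒᵖ` of affine schemes. -/
def zariskiTopology : GrothendieckTopology Cᵒᵖ := T.zariskiPrecoverage.toGrothendieck

/-- Presheaves on affine schemes. The site is large, so the values are taken in the next
universe; this makes sheafification available. -/
abbrev _root_.F1Toric.AffPresheaf (C : Type (u + 1)) [LargeCategory.{u} C] :
    Type (u + 2) := (Cᵒᵖ)ᵒᵖ ⥤ Type (u + 1)

/-- Zariski sheaves on affine schemes. -/
abbrev Sh : Type (u + 2) := Sheaf T.zariskiTopology (Type (u + 1))

/-- The presheaf represented by `Spec A`, i.e. `B ↦ Hom(A, B)`. -/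
abbrev _root_.F1Toric.rep (A : C) : AffPresheaf C := uliftYoneda.{u + 1}.obj (op A)

instance hasColimitsOfShape_sh (K : Type u) [SmallCategory K] : HasColimitsOfShape K T.Sh := by
  have : Small.{u + 1} K := small_succ K
  have : HasColimitsOfShape K (Type (u + 1)) := Types.hasColimitsOfShape
  infer_instance

instance hasCoproductsOfShape_sh (ι : Type u) : HasCoproductsOfShape ι T.Sh :=
  hasColimitsOfShape_sh T (Discrete ι)

instance hasCoequalizers_sh : HasCoequalizers T.Sh := by
  have : HasColimitsOfShape WalkingParallelPair (Type (u + 1)) := Types.hasColimitsOfShape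
  infer_instance

/-- The affine scheme `Spec A` as a sheaf. (Representable presheaves are sheaves, so that
sheafification does not change them.) -/
abbrev spec (A : C) : T.Sh := (presheafToSheaf T.zariskiTopology (Type (u + 1))).obj (rep A)

/-- The morphism of affine schemes attached to `A ⟶ B`. -/
abbrev specMap {A B : C} (φ : A ⟶ B) : T.spec B ⟶ T.spec A :=
  (presheafToSheaf T.zariskiTopology (Type (u + 1))).map (uliftYoneda.{u + 1}.map φ.op)

/-- A morphism of sheaves `f : F ⟶ G` is a Zariski open immersion: it is a monomorphism and
for every `x : Spec A → G` there is a family of Zariski opens `Spec B_i → Spec A` such that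
the subsheaf `F ×_G Spec A` of `Spec A` is the image of `∐ Spec B_i → Spec A`, that is, a point
`a : Spec D → Spec A` lies in `F ×_G Spec A` iff, locally on `Spec D`, it factors through one of
the `Spec B_i`. -/
structure IsOpenImmersion {F G : AffPresheaf C} (f : F ⟶ G) : Prop where
  injective : ∀ X, Function.Injective (f.app X)
  image : ∀ (A : C) (x : G.obj (op (op A))),
    ∃ (ι : Type u) (B : ι → C) (φ : ∀ i, A ⟶ B i), (∀ i, T.IsZariskiOpen (φ i)) ∧
      ∀ (D : C) (a : A ⟶ D),
        G.map a.op.op x ∈ Set.range (f.app (op (op D))) ↔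
          ∃ S ∈ T.zariskiTopology (op D), ∀ ⦃D' : C⦄ (d : D ⟶ D'), S d.op →
            ∃ (i : ι) (b : B i ⟶ D'), φ i ≫ b = a ≫ d

/-- The family of morphisms `p i : Spec (A i) → F` is an affine Zariski covering of the sheaf
`F`: each `p i` is a Zariski open immersion and `∐ Spec (A i) → F` is an epimorphism of sheaves
(i.e. locally surjective). -/
structure IsAffineCovering {F : AffPresheaf C} {ι : Type u} {A : ι → C}
    (p : ∀ i, rep (A i) ⟶ F) : Prop where
  isOpenImmersion : ∀ i, T.IsOpenImmersion (p i)
  epi : ∀ (D : C) (y : F.obj (op (op D))), ∃ S ∈ T.zariskiTopology (op D),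
    ∀ ⦃D' : C⦄ (d : D ⟶ D'), S d.op →
      ∃ i, F.map d.op.op y ∈ Set.range ((p i).app (op (op D')))

/-- A sheaf is a scheme if it has an affine Zariski covering. -/
def IsScheme (F : T.Sh) : Prop :=
  ∃ (ι : Type u) (A : ι → C) (p : ∀ i, rep (A i) ⟶ F.obj), T.IsAffineCovering p

/-- Base change of sheaves along a symmetric monoidal left adjoint `f`, in terms of the functor
`g : Comm(𝓔') ⥤ Comm(𝓔)` induced by the right adjoint of `f`: the sheaf associated with
`X ↦ F (g X)`. -/
def baseChange {C' : Type (u + 1)} [LargeCategory.{u} C'] (T' : ModuleTheory C') (g : C' ⥤ C) :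
    T.Sh ⥤ T'.Sh :=
  sheafToPresheaf _ _ ⋙ (Functor.whiskeringLeft _ _ _).obj g.op.op ⋙
    presheafToSheaf T'.zariskiTopology (Type (u + 1))

end ModuleTheory

/-- The base change `- ⊗_{𝔽₁} ℕ`, attached to the functor sending a semiring to its
multiplicative monoid. -/
def baseChangeF1N : overF1.{u}.Sh ⥤ overN.{u}.Sh :=
  overF1.baseChange overN (forget₂ CommSemiRingCat.{u} CommMonCat.{u})

/-- The base change `- ⊗_ℕ ℤ`, attached to the functor viewing a ring as a semiring. -/
def baseChangeNZ : overN.{u}.Sh ⥤ overZ.{u}.Sh :=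
  overN.baseChange overZ (forget₂ CommRingCat.{u} CommSemiRingCat.{u})

/-- The base change `- ⊗_{𝔽₁} ℤ`. -/
def baseChangeF1Z : overF1.{u}.Sh ⥤ overZ.{u}.Sh := baseChangeF1N ⋙ baseChangeNZ

/-- The functor of points `R ↦ Hom(Spec R, X)` of a scheme `X` in the usual sense. -/
def functorOfPoints (X : AlgebraicGeometry.Scheme.{u}) : AffPresheaf CommRingCat.{u} :=
  AlgebraicGeometry.Scheme.Spec.op ⋙ uliftYoneda.{u + 1}.obj X

end RelativeGeometry

section ToricF1

variable {N : Type u} [AddCommGroup N] (Δ : Fan N)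

/-- The affine `𝔽₁`-scheme `U_σ = Spec M_σ`. -/
def toricU (σ : PointedCone ℝ (RealSpan N)) : overF1.{u}.Sh := overF1.spec (coneMonoid σ)

/-- The morphism `U_τ → U_σ` for `τ ⊆ σ`. -/
def toricUMap {τ σ : PointedCone ℝ (RealSpan N)} (h : τ ≤ σ) : toricU τ ⟶ toricU σ :=
  overF1.specMap (coneMonoidMap h)

/-- The sheaf `X = ∐_σ U_σ`. -/
def toricX : overF1.{u}.Sh := ∐ fun σ : Δ.cones => toricU σ.1

/-- The sheaf `R = ∐_{σ,σ'} U_{σ ∩ σ'}`. -/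
def toricR : overF1.{u}.Sh := ∐ fun p : Δ.cones × Δ.cones => toricU (p.1.1 ⊓ p.2.1)

/-- The first projection `R ⟶ X`, given by `U_{σ ∩ σ'} → U_σ`. -/
def toricFst : toricR Δ ⟶ toricX Δ :=
  Limits.Sigma.desc fun p => toricUMap inf_le_left ≫ Limits.Sigma.ι (fun σ : Δ.cones => toricU σ.1) p.1

/-- The second projection `R ⟶ X`, given by `U_{σ ∩ σ'} → U_σ'`. -/
def toricSnd : toricR Δ ⟶ toricX Δ :=
  Limits.Sigma.desc fun p => toricUMap inf_le_right ≫ Limits.Sigma.ι (fun σ : Δ.cones => toricU σ.1) p.2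

/-- The quotient sheaf `X_{𝔽₁}(Δ) = X / R`. -/
def toricF1 : overF1.{u}.Sh := coequalizer (toricFst Δ) (toricSnd Δ)

/-- The chart `U_σ → X_{𝔽₁}(Δ)`. -/
def toricChart (σ : Δ.cones) : toricU σ.1 ⟶ toricF1 Δ :=
  Limits.Sigma.ι (fun σ : Δ.cones => toricU σ.1) σ ≫ coequalizer.π (toricFst Δ) (toricSnd Δ)

/-- The chart `Spec M_σ → X_{𝔽₁}(Δ)` on the represented presheaf. -/
def toricChartRep (σ : Δ.cones) : rep (coneMonoid σ.1) ⟶ (toricF1 Δ).obj :=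
  toSheafify overF1.zariskiTopology (rep (coneMonoid σ.1)) ≫ (toricChart Δ σ).hom

end ToricF1

end F1Toric

end

/-! The proof rests on the triviality of the Zariski topology over `𝔽₁`. The non-units of a monoid
`A` behave like a unique maximal ideal: the `A`-set `{0, 1}`, on which units fix everything and
non-units act by `0`, collapses to a point after any extension that inverts a non-unit. Hence some
member of every covering reflects units, and a flat morphism reflecting units is an isomorphism
(`zariskiTopology_overF1_eq_bot`). All presheaves are therefore sheaves, and coproducts and
coequalizers are computed on sections, so a section of `X / R` over `D` is a class of monoid
morphisms `M_σ ⟶ D`.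

The toric input is that a face `τ` of `σ` is cut out by some `m ∈ M_σ` and that `M_τ` is the
localization `M_σ[-m]`. Localizations are flat by clearing denominators (`IsMonoidAway.flat`), and
`f : M_σ ⟶ D` extends to `M_τ` exactly when `f m` is a unit. Transitivity of `R`
(`AgreeOnInf.trans`) and the openness of the charts both follow from this.

Over `ℤ`, a relative Zariski covering contains a finite, flat, jointly surjective family, so it is
an fpqc covering, and functors of points of schemes are sheaves by fpqc descent
(`isSheaf_functorOfPoints`). The comparison from `R ↦ X_{𝔽₁}(Δ)(R, ·)` to the functor of points of
`X_ℤ(Δ)` is injective, because the same relation `AgreeOnInf` governs equality on both sides, and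
locally surjective, because the charts cover the toric scheme. The intermediate sheafification over
`ℕ` has no effect on the result: a covering of a semiring, base changed to a ring, becomes a
covering by rings (`isCocontinuous_forget₂_op`), so the unit of that sheafification remains locally
bijective on rings. -/

noncomputable section

namespace F1Toric

/-! ### Flat morphisms of monoids and the triviality of the Zariski topology over `𝔽₁`. -/

section ASetGeometry

variable {A B : CommMonCat.{u}}

/-- The morphism of `A`-sets `A → Y` sending `1` to `y`. -/
def aSetElement (Y : Action (Type u) A) (y : Y.V) : Action.leftRegular A ⟶ Y where
  hom := TypeCat.ofHom fun a => Y.ρ a y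
  comm a := by
    refine ConcreteCategory.hom_ext (C := Type u) _ _ fun (b : A) => ?_
    change Y.ρ (a * b) y = Y.ρ a (Y.ρ b y)
    rw [map_mul]
    rfl

@[simp] lemma aSetElement_hom (Y : Action (Type u) A) (y : Y.V) (a : A) :
    (aSetElement Y y).hom a = Y.ρ a y := rfl

lemma aSetElement_one (Y : Action (Type u) A) (y : Y.V) :
    (aSetElement Y y).hom (1 : A) = y := by
  rw [aSetElement_hom, map_one]; rfl

lemma aSetElement_ext {Y : Action (Type u) A} {f g : Action.leftRegular A ⟶ Y}
    (h : f.hom (1 : A) = g.hom (1 : A)) : f = g := by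
  refine Action.Hom.ext (ConcreteCategory.hom_ext (C := Type u) _ _ fun (a : A) => ?_)
  have hf := ConcreteCategory.congr_hom (f.comm a) (1 : A)
  have hg := ConcreteCategory.congr_hom (g.comm a) (1 : A)
  change f.hom (a * 1 : A) = Y.ρ a (f.hom (1 : A)) at hf
  change g.hom (a * 1 : A) = Y.ρ a (g.hom (1 : A)) at hg
  rw [mul_one] at hf hg
  rw [hf, hg, h]

variable (φ : A ⟶ B)

/-- The value `b φ(a)` of the element `b ⊗ a` of `B ⊗_A A`. -/
def aSetTensorRegular : ASetTensor φ (Action.leftRegular A) → B :=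
  Quot.lift (fun p => p.1 * φ.hom p.2) (by
    rintro _ _ ⟨b, a, (x : A), rfl, rfl⟩
    change b * φ.hom a * φ.hom x = b * φ.hom (a * x)
    rw [map_mul, mul_assoc])

/-- Preservation of the product `A × A`: the pair `(b, b')` lifts to an element `c ⊗ x` of `B ⊗_A (A
× A)`, and `a`, `a'` are the coordinates of `x`. -/
lemma exists_eq_mul_of_flat [PreservesFiniteLimits (aSetExtend φ)] (b b' : B) :
    ∃ (c : B) (a a' : A), b = c * φ.hom a ∧ b' = c * φ.hom a' := by
  let R := Action.leftRegular A
  let h := isLimitOfHasBinaryProductOfPreservesLimit (aSetExtend φ) R R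
  obtain ⟨l, hl, hl'⟩ := BinaryFan.IsLimit.lift' h
    (aSetElement ((aSetExtend φ).obj R) (ASetTensor.mk φ b (1 : A)))
    (aSetElement ((aSetExtend φ).obj R) (ASetTensor.mk φ b' (1 : A)))
  obtain ⟨⟨c, x⟩, hx⟩ := Quot.exists_rep (l.hom (1 : B))
  have e : ∀ (p : R ⨯ R ⟶ R) (d : B),
      l ≫ (aSetExtend φ).map p = aSetElement _ (ASetTensor.mk φ d (1 : A)) →
      d = c * φ.hom (p.hom x) := by
    intro p d hp
    have h1 : ((aSetExtend φ).map p).hom (l.hom (1 : B)) = ASetTensor.mk φ d (1 : A) := by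
      rw [← aSetElement_one ((aSetExtend φ).obj R) (ASetTensor.mk φ d (1 : A)), ← hp]
      rfl
    rw [← hx] at h1
    have h2 := congrArg (aSetTensorRegular φ) h1
    change c * φ.hom (p.hom x) = d * φ.hom 1 at h2
    rw [map_one, mul_one] at h2
    exact h2.symm
  exact ⟨c, _, _, e _ _ hl, e _ _ hl'⟩

/-- Preservation of the equalizer of multiplication by `a` and by `a'` on `A`: since `1 ⊗ 1`
equalizes the extended maps, it equals some `c ⊗ s` with `s` in the equalizer. -/
lemma exists_mul_eq_mul_of_flat [PreservesFiniteLimits (aSetExtend φ)] {a a' : A}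
    (h : φ.hom a = φ.hom a') :
    ∃ (c : B) (s : A), c * φ.hom s = 1 ∧ s * a = s * a' := by
  let R := Action.leftRegular A
  let f : R ⟶ R := aSetElement R a
  let g : R ⟶ R := aSetElement R a'
  let hlim := isLimitOfHasEqualizerOfPreservesLimit (aSetExtend φ) f g
  have e1 : aSetElement ((aSetExtend φ).obj R) (ASetTensor.mk φ (1 : B) (1 : A)) ≫
      (aSetExtend φ).map f =
      aSetElement ((aSetExtend φ).obj R) (ASetTensor.mk φ (1 : B) (1 : A)) ≫
      (aSetExtend φ).map g := by
    refine aSetElement_ext ?_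
    change ASetTensor.mk φ (X := R) ((1 : B) * 1) ((1 : A) * a) =
      ASetTensor.mk φ (X := R) ((1 : B) * 1) ((1 : A) * a')
    have h1 : ∀ a : A, ASetTensor.mk φ (X := R) ((1 : B) * 1) ((1 : A) * a) =
        ASetTensor.mk φ (X := R) (φ.hom a) (1 : A) := by
      intro a
      have h2 : R.ρ a (1 : A) = a := mul_one a
      have h3 := ASetTensor.mk_mul φ (X := R) 1 a (1 : A)
      rw [one_mul, h2] at h3
      rw [one_mul, one_mul]
      exact h3.symm
    rw [h1, h1, h]
  obtain ⟨l, hl⟩ := Fork.IsLimit.lift' hlim _ e1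
  obtain ⟨⟨c, x⟩, hx⟩ := Quot.exists_rep (l.hom (1 : B))
  refine ⟨c, (equalizer.ι f g).hom x, ?_, ?_⟩
  · have h1 : ((aSetExtend φ).map (equalizer.ι f g)).hom (l.hom (1 : B)) =
        ASetTensor.mk φ ((1 : B) * 1) (1 : A) := by
      have := ConcreteCategory.congr_hom (congrArg Action.Hom.hom hl) (1 : B)
      exact this
    rw [← hx] at h1
    have h2 := congrArg (aSetTensorRegular φ) h1
    change c * φ.hom _ = 1 * 1 * φ.hom 1 at h2
    rw [map_one, mul_one, mul_one] at h2
    exact h2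
  · exact ConcreteCategory.congr_hom (congrArg Action.Hom.hom (equalizer.condition f g)) x

/-- A flat morphism of monoids that reflects units is an isomorphism. -/
lemma isIso_of_flat_of_isLocalHom [PreservesFiniteLimits (aSetExtend φ)]
    (hloc : ∀ a : A, IsUnit (φ.hom a) → IsUnit a) : IsIso φ := by
  rw [ConcreteCategory.isIso_iff_bijective]
  constructor
  · intro a a' h
    obtain ⟨c, s, hs, hsa⟩ := exists_mul_eq_mul_of_flat φ h
    have : IsUnit s := hloc s (IsUnit.of_mul_eq_one c (by rw [mul_comm]; exact hs))
    exact this.mul_left_cancel hsa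
  · intro b
    -- Pairing `b` with `1` makes `φ a'` a unit, hence `a'` a unit, so the common factor `c` is the
    -- image of its inverse.
    obtain ⟨c, a, a', hb, h1⟩ := exists_eq_mul_of_flat φ b 1
    obtain ⟨v, rfl⟩ := hloc a' (IsUnit.of_mul_eq_one c (by rw [mul_comm]; exact h1.symm))
    refine ⟨a * (v⁻¹ : Aˣ), ?_⟩
    have hc : c = φ.hom (v⁻¹ : Aˣ) := by
      have : φ.hom (v : A) * φ.hom (v⁻¹ : Aˣ) = 1 := by rw [← map_mul]; simp
      rw [← one_mul (φ.hom (v⁻¹ : Aˣ)), h1, mul_assoc, this, mul_one]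
    change φ.hom _ = b
    rw [hb, hc, map_mul, mul_comm]

open Classical in
/-- The `A`-set `{0, 1}` on which the units act trivially and all other elements act by `0`. -/
def unitIndicator (A : CommMonCat.{u}) : Action (Type u) A where
  V := ULift.{u} Bool
  ρ :=
    { toFun := fun a => TypeCat.ofHom fun x => ⟨decide (IsUnit a) && x.down⟩
      map_one' := by
        refine ConcreteCategory.hom_ext (C := Type u) _ _ fun x => ?_
        change (⟨decide (IsUnit (1 : A)) && x.down⟩ : ULift.{u} Bool) = x
        simp
      map_mul' := by
        intro a b
        refine ConcreteCategory.hom_ext (C := Type u) _ _ fun x => ?_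
        change (⟨decide (IsUnit (a * b)) && x.down⟩ : ULift.{u} Bool) =
          ⟨decide (IsUnit a) && (decide (IsUnit b) && x.down)⟩
        simp [IsUnit.mul_iff, Bool.and_assoc] }

/-- The `A`-set with one element. -/
def pointASet (A : CommMonCat.{u}) : Action (Type u) A where
  V := PUnit
  ρ := 1

/-- The morphism from `unitIndicator` to the one-element `A`-set. -/
def unitIndicatorToPoint (A : CommMonCat.{u}) : unitIndicator A ⟶ pointASet A where
  hom := TypeCat.ofHom fun _ => PUnit.unit
  comm _ := rfl

/-- The zero section of `unitIndicatorToPoint`. -/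
def pointToUnitIndicator (A : CommMonCat.{u}) : pointASet A ⟶ unitIndicator A where
  hom := TypeCat.ofHom fun _ => ⟨false⟩
  comm a := by
    refine ConcreteCategory.hom_ext (C := Type u) _ _ fun x => ?_
    exact congrArg ULift.up (Bool.and_false _).symm

lemma not_isIso_unitIndicatorToPoint (A : CommMonCat.{u}) : ¬ IsIso (unitIndicatorToPoint A) := by
  intro h
  have h1 : IsIso ((Action.forget (Type u) A).map (unitIndicatorToPoint A)) := inferInstance
  have h2 := (ConcreteCategory.bijective_of_isIso
    ((Action.forget (Type u) A).map (unitIndicatorToPoint A))).1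
  have h3 : (⟨true⟩ : ULift.{u} Bool) = ⟨false⟩ := h2 rfl
  simp at h3

/-- For `y` equal to `0` or `1`, `b ⊗ y = b φ(a)⁻¹ ⊗ a y = b φ(a)⁻¹ ⊗ 0`, so the two elements become
indistinguishable. -/
lemma isIso_extend_unitIndicatorToPoint {a : A} (ha : ¬ IsUnit a) (h : IsUnit (φ.hom a)) :
    IsIso ((aSetExtend φ).map (unitIndicatorToPoint A)) := by
  refine ⟨(aSetExtend φ).map (pointToUnitIndicator A), ?_, ?_⟩
  · ext ⟨b, x⟩
    change ASetTensor.mk φ (X := unitIndicator A) b (⟨false⟩ : ULift Bool) = ASetTensor.mk φ (X := unitIndicator A) b x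
    obtain ⟨v, hv⟩ := h
    have key : ∀ y : (unitIndicator A).V, ASetTensor.mk φ (X := unitIndicator A) b y =
        ASetTensor.mk φ (X := unitIndicator A) (b * (v⁻¹ : Bˣ)) (⟨false⟩ : ULift Bool) := by
      intro y
      have h1 : (unitIndicator A).ρ a y = (⟨false⟩ : ULift Bool) := by
        classical
        exact congrArg (fun t => ULift.up (t && y.down)) (decide_eq_false ha)
      rw [← h1, ← ASetTensor.mk_mul, ← hv, mul_assoc, Units.inv_mul, mul_one]
    rw [key (⟨false⟩ : ULift Bool), key x]
  · rw [← Functor.map_comp]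
    exact (aSetExtend φ).map_id _

/-- Every Zariski covering of an affine scheme over `𝔽₁` contains an isomorphism. -/
lemma zariskiTopology_overF1_eq_bot : overF1.{u}.zariskiTopology = ⊥ := by
  refine le_bot_iff.1 ?_
  rw [ModuleTheory.zariskiTopology, Precoverage.toGrothendieck_eq_sInf]
  refine sInf_le ?_
  intro X P hP
  obtain ⟨hP, n, B, φ, hφ, hcons⟩ := hP
  rw [GrothendieckTopology.bot_covering]
  -- Otherwise every `φ i` inverts a non-unit, and `unitIndicatorToPoint` would contradict joint
  -- conservativity.
  obtain ⟨i, hi⟩ : ∃ i, ∀ a, IsUnit ((φ i).hom a) → IsUnit a := by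
    by_contra! hne
    refine not_isIso_unitIndicatorToPoint X.unop (hcons _ fun i => ?_)
    obtain ⟨a, ha, ha'⟩ := hne i
    exact isIso_extend_unitIndicatorToPoint (φ i) ha' ha
  have : PreservesFiniteLimits (aSetExtend (φ i)) := (hP _ (hφ i)).flat
  have : IsIso (φ i) := isIso_of_flat_of_isLocalHom (φ i) hi
  rw [← Sieve.id_mem_iff_eq_top]
  exact ⟨_, (inv (φ i)).op, (φ i).op, hφ i, by rw [← op_comp]; simp⟩

end ASetGeometry

/-! ### Localizations of monoids are Zariski opens. -/

section MonoidLocalizationFlat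

variable {A B : CommMonCat.{u}} {φ : A ⟶ B} {m : A}

/-- `φ : A ⟶ B` is the localization of the monoid `A` that inverts `m`. -/
structure IsMonoidAway (φ : A ⟶ B) (m : A) : Prop where
  isUnit : IsUnit (φ.hom m)
  surj : ∀ b : B, ∃ (k : ℕ) (a : A), b * φ.hom m ^ k = φ.hom a
  exists_of_eq : ∀ {a a' : A}, φ.hom a = φ.hom a' → ∃ k : ℕ, m ^ k * a = m ^ k * a'

namespace IsMonoidAway

lemma exists_lift (h : IsMonoidAway φ m) {D : CommMonCat.{u}} (f : A ⟶ D)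
    (hf : IsUnit (f.hom m)) : ∃ g : B ⟶ D, φ ≫ g = f := by
  let L : (Submonoid.powers m).LocalizationMap B :=
    { toMulHom := φ.hom
      isLocalizationMap :=
        { map_units := by
            rintro ⟨_, k, rfl⟩
            change IsUnit (φ.hom (m ^ k))
            rw [map_pow]
            exact h.isUnit.pow k
          surj := fun b => by
            obtain ⟨k, a, hk⟩ := h.surj b
            refine ⟨(a, ⟨_, k, rfl⟩), ?_⟩
            change b * φ.hom (m ^ k) = φ.hom a
            rw [map_pow, hk]
          exists_of_eq := fun {a a'} e => by
            obtain ⟨k, hk⟩ := h.exists_of_eq e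
            exact ⟨⟨_, k, rfl⟩, hk⟩ } }
  have hu : ∀ y : Submonoid.powers m, IsUnit (f.hom y) := by
    rintro ⟨_, k, rfl⟩
    change IsUnit (f.hom (m ^ k))
    rw [map_pow]
    exact hf.pow k
  refine ⟨CommMonCat.ofHom (L.lift hu), ?_⟩
  ext a
  exact L.lift_eq hu a

lemma epi (h : IsMonoidAway φ m) : Epi φ := by
  constructor
  intro D f g hfg
  ext b
  obtain ⟨k, a, hb⟩ := h.surj b
  have hu : IsUnit (f.hom (φ.hom m) ^ k) := (h.isUnit.map f.hom).pow k
  have e : ∀ a, f.hom (φ.hom a) = g.hom (φ.hom a) := fun a => ConcreteCategory.congr_hom hfg a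
  refine hu.mul_right_cancel ?_
  calc f.hom b * f.hom (φ.hom m) ^ k
      _ = f.hom (φ.hom a) := by rw [← hb, map_mul, map_pow]
      _ = g.hom (φ.hom a) := e a
      _ = g.hom b * f.hom (φ.hom m) ^ k := by rw [← hb, map_mul, map_pow, e]

/-- An algebra map out of the localization is unique, and it exists when `m` becomes invertible. In
a filtered colimit, an inverse of `m` and the relation that makes it one already live at some stage.
-/
lemma finitePresentation (h : IsMonoidAway φ m) : IsFinitelyPresentable.{u} (Under.mk φ) := by
  have := h.epi
  have hsub : ∀ (Y : Under A) (f g : Under.mk φ ⟶ Y), f = g := by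
    intro Y f g
    ext1
    rw [← cancel_epi φ]
    exact (Under.w f).trans (Under.w g).symm
  rw [isFinitelyPresentable_iff_preservesFilteredColimits]
  refine ⟨fun J _ _ => ⟨fun {F} => ⟨fun {c} hc => ⟨Types.FilteredColimit.isColimitOf _ _ ?_ ?_⟩⟩⟩⟩
  · intro (f : Under.mk φ ⟶ c.pt)
    have hc' := isColimitOfPreserves (Under.forget A ⋙ forget CommMonCat) hc
    obtain ⟨w, hw⟩ : IsUnit (c.pt.hom m) := by
      have := h.isUnit.map f.right.hom
      rwa [show f.right.hom (φ.hom m) = c.pt.hom m from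
        ConcreteCategory.congr_hom (Under.w f) m] at this
    obtain ⟨j, (t : (F.obj j).right), ht⟩ := Types.jointly_surjective_of_isColimit hc' ((w⁻¹ : _ˣ) : c.pt.right)
    replace ht : (c.ι.app j).right t = ((w⁻¹ : _ˣ) : c.pt.right) := ht
    have hs : (c.ι.app j).right ((F.obj j).hom m) = (w : c.pt.right) := by
      rw [hw]
      exact ConcreteCategory.congr_hom (Under.w (c.ι.app j)) m
    have h1 : (c.ι.app j).right ((F.obj j).hom m * t : (F.obj j).right) =
        (c.ι.app j).right (1 : (F.obj j).right) := by
      rw [map_mul, hs, ht, map_one, Units.mul_inv]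
    obtain ⟨k, p, q, hpq⟩ := (Types.FilteredColimit.isColimit_eq_iff _ hc').1 h1
    replace hpq : (F.map p).right ((F.obj j).hom m * t : (F.obj j).right) =
      (F.map q).right (1 : (F.obj j).right) := hpq
    rw [map_mul, map_one] at hpq
    have hu : IsUnit ((F.obj k).hom.hom m) := by
      have : (F.map p).right ((F.obj j).hom m) = (F.obj k).hom.hom m :=
        ConcreteCategory.congr_hom (Under.w (F.map p)) m
      rw [← this]
      exact IsUnit.of_mul_eq_one _ hpq
    obtain ⟨g, hg⟩ := h.exists_lift _ hu
    exact ⟨k, Under.homMk g hg, hsub _ _ _⟩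
  · intro i j f g _
    obtain ⟨k, p, q, -⟩ := IsFilteredOrEmpty.cocone_objs i j
    exact ⟨k, p, q, hsub _ _ _⟩

variable {X : Action (Type u) A}

/-- The right-hand side is an equivalence relation containing the generators, so it contains the
equivalence relation generated by them; the converse divides by `m ^ k`. -/
lemma mk_eq_iff (h : IsMonoidAway φ m) {b b' : B} {x x' : X.V} :
    ASetTensor.mk φ b x = ASetTensor.mk φ b' x' ↔ ∃ (k : ℕ) (a a' : A),
      b * φ.hom m ^ k = φ.hom a ∧ b' * φ.hom m ^ k = φ.hom a' ∧ X.ρ a x = X.ρ a' x' := by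
  have hρ : ∀ (a a' : A) (x : X.V), X.ρ (a * a') x = X.ρ a (X.ρ a' x) := fun a a' x => by
    rw [map_mul]; rfl
  constructor
  · intro e
    have e' := Quot.eqvGen_exact e
    let P : B × X.V → B × X.V → Prop := fun p q => ∃ (k : ℕ) (a a' : A),
      p.1 * φ.hom m ^ k = φ.hom a ∧ q.1 * φ.hom m ^ k = φ.hom a' ∧ X.ρ a p.2 = X.ρ a' q.2
    change P (b, x) (b', x')
    generalize (b, x) = p at e' ⊢
    generalize (b', x') = q at e' ⊢
    induction e' with
    | rel p q hpq =>
      obtain ⟨b, a, x, rfl, rfl⟩ := hpq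
      obtain ⟨k, c, hc⟩ := h.surj b
      refine ⟨k, c * a, c, ?_, hc, hρ _ _ _⟩
      change b * φ.hom a * _ = _
      rw [map_mul, ← hc]
      exact mul_right_comm _ _ _
    | refl p =>
      obtain ⟨k, c, hc⟩ := h.surj p.1
      exact ⟨k, c, c, hc, hc, rfl⟩
    | symm p q _ ih =>
      obtain ⟨k, a, a', h1, h2, h3⟩ := ih
      exact ⟨k, a', a, h2, h1, h3.symm⟩
    | trans p q r _ _ ih1 ih2 =>
      obtain ⟨k, a, a', h1, h2, h3⟩ := ih1
      obtain ⟨l, c, c', h4, h5, h6⟩ := ih2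
      -- Both `a'` and `c` are numerators of `q.1`, for the denominators `m ^ k` and `m ^ l`; after
      -- cross-multiplication they agree up to a power of `m`.
      obtain ⟨n, hn⟩ : ∃ n : ℕ, m ^ n * (m ^ l * a') = m ^ n * (m ^ k * c) := by
        refine h.exists_of_eq ?_
        rw [map_mul, map_mul, map_pow, map_pow, ← h2, ← h4]
        rw [mul_left_comm, mul_left_comm _ q.1, mul_comm (φ.hom m ^ l)]
      refine ⟨n + (l + k), m ^ n * (m ^ l * a), m ^ n * (m ^ k * c'), ?_, ?_, ?_⟩
      · rw [map_mul, map_mul, map_pow, map_pow, ← h1, pow_add, pow_add]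
        ac_rfl
      · rw [map_mul, map_mul, map_pow, map_pow, ← h5, pow_add, pow_add]
        ac_rfl
      · rw [hρ, hρ, h3, ← hρ, ← hρ, mul_assoc, hn, hρ, hρ, h6, ← hρ, ← hρ, mul_assoc]
  · rintro ⟨k, a, a', h1, h2, h3⟩
    obtain ⟨v, hv⟩ := h.isUnit.pow k
    rw [← hv] at h1 h2
    have e : ∀ (b : B) (a : A) (x : X.V), b * v = φ.hom a →
        ASetTensor.mk φ b x = ASetTensor.mk φ (v⁻¹ : Bˣ) (X.ρ a x) := by
      intro b a x hb
      rw [← ASetTensor.mk_mul, ← hb, mul_comm b, Units.inv_mul_cancel_left]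
    rw [e b a x h1, e b' a' x' h2, h3]

/-- The fraction `x / m ^ k` in `B ⊗_A X`. -/
def frac (h : IsMonoidAway φ m) (x : X.V) (k : ℕ) : ASetTensor φ X :=
  ASetTensor.mk φ (((h.isUnit.unit ^ k)⁻¹ : Bˣ) : B) x

lemma frac_eq_frac_iff (h : IsMonoidAway φ m) {x y : X.V} {k : ℕ} :
    h.frac x k = h.frac y k ↔ ∃ n : ℕ, X.ρ (m ^ n) x = X.ρ (m ^ n) y := by
  have hρ : ∀ (a a' : A) (x : X.V), X.ρ (a * a') x = X.ρ a (X.ρ a' x) := fun a a' x => by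
    rw [map_mul]; rfl
  rw [frac, frac, h.mk_eq_iff]
  constructor
  · rintro ⟨l, a, a', h1, h2, h3⟩
    -- Numerators of `m ^ l / m ^ k` are, up to multiplication by powers of `m`, powers of `m`
    -- themselves.
    have key : ∀ a, (((h.isUnit.unit ^ k)⁻¹ : Bˣ) : B) * φ.hom m ^ l = φ.hom a →
        φ.hom (m ^ k * a) = φ.hom (m ^ l) := by
      intro a ha
      rw [map_mul, ← ha, map_pow, map_pow]
      have : φ.hom m ^ k = ((h.isUnit.unit ^ k : Bˣ) : B) := by simp
      rw [this, Units.mul_inv_cancel_left]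
    obtain ⟨n, hn⟩ := h.exists_of_eq (key a h1)
    obtain ⟨n', hn'⟩ := h.exists_of_eq (key a' h2)
    have e : m ^ (n' + n + l) = m ^ (n' + n + k) * a := by
      rw [pow_add, pow_add, mul_assoc, ← hn]; simp only [pow_add, mul_assoc]
    have e' : m ^ (n' + n + l) = m ^ (n' + n + k) * a' := by
      rw [add_comm n' n, pow_add, pow_add, mul_assoc, ← hn']; simp only [pow_add, mul_assoc]
    refine ⟨n' + n + l, ?_⟩
    conv_lhs => rw [e]
    rw [e', hρ, hρ, h3]
  · rintro ⟨n, hn⟩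
    refine ⟨k + n, m ^ n, m ^ n, ?_, ?_, hn⟩
    all_goals
      rw [map_pow, pow_add]
      have : φ.hom m ^ k = ((h.isUnit.unit ^ k : Bˣ) : B) := by simp
      rw [this, Units.inv_mul_cancel_left]

lemma frac_add (h : IsMonoidAway φ m) (x : X.V) (k n : ℕ) :
    h.frac (X.ρ (m ^ n) x) (k + n) = h.frac x k := by
  rw [frac, frac, ← ASetTensor.mk_mul, pow_add, mul_inv, map_pow]
  congr 1
  have : φ.hom m ^ n = ((h.isUnit.unit ^ n : Bˣ) : B) := by simp
  rw [this, Units.val_mul, Units.inv_mul_cancel_right]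

/-- Every sufficiently large exponent is allowed, so that finitely many elements can be given one
common denominator. -/
lemma exists_frac (h : IsMonoidAway φ m) (z : ASetTensor φ X) :
    ∃ k : ℕ, ∀ n, k ≤ n → ∃ x : X.V, z = h.frac x n := by
  obtain ⟨⟨b, x⟩, rfl⟩ := Quot.exists_rep z
  obtain ⟨k, a, hk⟩ := h.surj b
  refine ⟨k, fun n hn => ?_⟩
  obtain ⟨n, rfl⟩ := Nat.exists_eq_add_of_le hn
  refine ⟨X.ρ (m ^ n) (X.ρ a x), ?_⟩
  rw [frac_add, frac, ← ASetTensor.mk_mul, ← hk]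
  have : φ.hom m ^ k = ((h.isUnit.unit ^ k : Bˣ) : B) := by simp
  rw [this, mul_comm b, Units.inv_mul_cancel_left]
  rfl

lemma rho_pow_of_le {n k : ℕ} (hnk : n ≤ k) {x y : X.V}
    (e : X.ρ (m ^ n) x = X.ρ (m ^ n) y) : X.ρ (m ^ k) x = X.ρ (m ^ k) y := by
  obtain ⟨l, rfl⟩ := Nat.exists_eq_add_of_le' hnk
  have hρ : ∀ x : X.V, X.ρ (m ^ (l + n)) x = X.ρ (m ^ l) (X.ρ (m ^ n) x) := fun x => by
    rw [pow_add, map_mul]; rfl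
  rw [hρ, hρ, e]

lemma hom_rho {X Y : Action (Type u) A} (f : X ⟶ Y) (a : A) (x : X.V) :
    f.hom (X.ρ a x) = Y.ρ a (f.hom x) :=
  ConcreteCategory.congr_hom (f.comm a) x

/-- A point of a finite limit of localizations is a finite family of fractions subject to finitely
many equations; one denominator and one power of `m` bring all of them back to the original diagram.
-/
lemma flat (h : IsMonoidAway φ m) : PreservesFiniteLimits (aSetExtend φ) := by
  classical
  suffices PreservesFiniteLimits (aSetExtend φ ⋙ Action.forget (Type u) B) from by
    have : (Action.forget (Type u) B).ReflectsIsomorphisms :=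
      ⟨fun f hf => by
        have : IsIso f.hom := hf
        exact Action.isIso_of_hom_isIso f⟩
    have : ReflectsFiniteLimits (Action.forget (Type u) B) :=
      ⟨fun J _ _ => reflectsLimitsOfShape_of_reflectsIsomorphisms⟩
    exact preservesFiniteLimits_of_reflects_of_preserves _ (Action.forget (Type u) B)
  refine ⟨fun J _ _ => ⟨fun {K} => ⟨fun {c} hc => ?_⟩⟩⟩
  have hc' := (Types.isLimit_iff _).1 ⟨isLimitOfPreserves (Action.forget (Type u) A) hc⟩
  rw [Types.isLimit_iff]
  intro s hs
  have hmap : ∀ {X Y : Action (Type u) A} (f : X ⟶ Y) (x : X.V) (k : ℕ),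
      ((aSetExtend φ ⋙ Action.forget (Type u) B).map f) (h.frac x k) = h.frac (f.hom x) k :=
    fun _ _ _ => rfl
  choose k hk using fun j => h.exists_frac (s j)
  choose y hy using fun j => hk j (Finset.univ.sup k) (Finset.le_sup (Finset.mem_univ j))
  set d := Finset.univ.sup k
  -- With the common denominator `m ^ d`, compatibility of the fractions is compatibility of the
  -- numerators up to a power of `m`, depending on `f`; `e` below bounds all these powers.
  have hcomp : ∀ (i j : J) (f : i ⟶ j), ∃ n : ℕ,
      (K.obj j).ρ (m ^ n) ((K.map f).hom (y i)) = (K.obj j).ρ (m ^ n) (y j) := by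
    intro i j f
    rw [← h.frac_eq_frac_iff (k := d), ← hmap, ← hy, ← hy]
    exact hs f
  choose n hn using hcomp
  let e := Finset.univ.sup fun i => Finset.univ.sup fun j => Finset.univ.sup fun f => n i j f
  have he : ∀ i j f, n i j f ≤ e := fun i j f =>
    (Finset.le_sup (f := fun f => n i j f) (Finset.mem_univ f)).trans
      ((Finset.le_sup (f := fun j => Finset.univ.sup fun f => n i j f) (Finset.mem_univ j)).trans
        (Finset.le_sup (f := fun i => Finset.univ.sup fun j => Finset.univ.sup fun f => n i j f)
          (Finset.mem_univ i)))
  have hπ : ∀ (j : J) (a : A) (x : c.pt.V),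
      (c.π.app j).hom (c.pt.ρ a x) = (K.obj j).ρ a ((c.π.app j).hom x) :=
    fun j => hom_rho (c.π.app j)
  -- The numerators multiplied by `m ^ e` are strictly compatible and define `z` in the limit; the
  -- extra factor is absorbed in the denominator `m ^ (d + e)`.
  obtain ⟨(z : c.pt.V), hz, -⟩ := hc' (fun j => (K.obj j).ρ (m ^ e) (y j)) (by
    intro i j f
    change (K.map f).hom ((K.obj i).ρ (m ^ e) (y i)) = _
    rw [hom_rho]
    exact rho_pow_of_le (he i j f) (hn i j f))
  refine ⟨h.frac (X := c.pt) z (d + e), fun j => ?_, ?_⟩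
  · refine (hmap (c.π.app j) z (d + e)).trans ?_
    rw [show (c.π.app j).hom z = _ from hz j, frac_add, hy]
  · intro w hw
    obtain ⟨k', hk'⟩ := h.exists_frac (X := c.pt) w
    obtain ⟨x, rfl⟩ := hk' (d + e + k') (Nat.le_add_left _ _)
    refine Eq.trans ?_ (h.frac_add (X := c.pt) z (d + e) k')
    refine h.frac_eq_frac_iff.2 ?_
    -- Uniqueness: the coordinates of the two numerators agree up to a power of `m` for each `j`,
    -- and the largest of these powers serves for all.
    have h1 : ∀ j, ∃ n : ℕ, (K.obj j).ρ (m ^ n) ((c.π.app j).hom x) =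
        (K.obj j).ρ (m ^ n) ((c.π.app j).hom (c.pt.ρ (m ^ k') z)) := by
      intro j
      refine (h.frac_eq_frac_iff (k := d + e + k')).1 ((hw j).trans ?_)
      rw [hπ, frac_add, show (c.π.app j).hom z = _ from hz j, frac_add, hy]
    choose p hp using h1
    refine ⟨Finset.univ.sup p, (hc' (fun j => (c.π.app j).hom (c.pt.ρ (m ^ Finset.univ.sup p) x))
      ?_).unique (fun j => rfl) (fun j => ?_)⟩
    · intro i j f
      exact ConcreteCategory.congr_hom (congrArg Action.Hom.hom (c.w f)) _
    · exact (hπ j _ _).trans ((rho_pow_of_le (Finset.le_sup (Finset.mem_univ j))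
        (hp j)).symm.trans (hπ j _ _).symm)

/-- Localizations of monoids are Zariski opens over `𝔽₁`. -/
lemma isZariskiOpen (h : IsMonoidAway φ m) : overF1.{u}.IsZariskiOpen φ :=
  ⟨h.flat, h.epi, h.finitePresentation⟩

/-- Needed for an arbitrary base `A` when testing that the charts are open. Unlike an inclusion of
cone monoids, this map need not be injective. -/
lemma localization (A : CommMonCat.{u}) (m : A) :
    IsMonoidAway (CommMonCat.ofHom (Localization.monoidOf (Submonoid.powers m)).toMonoidHom :
      A ⟶ CommMonCat.of (Localization (Submonoid.powers m))) m where
  isUnit := (Localization.monoidOf (Submonoid.powers m)).map_units ⟨m, 1, pow_one m⟩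
  surj b := by
    obtain ⟨⟨a, _, k, rfl⟩, hk⟩ := (Localization.monoidOf (Submonoid.powers m)).surj b
    refine ⟨k, a, ?_⟩
    rw [← map_pow]
    exact hk
  exists_of_eq e := by
    obtain ⟨⟨_, k, rfl⟩, hk⟩ := (Localization.monoidOf (Submonoid.powers m)).exists_of_eq e
    exact ⟨k, hk⟩

end IsMonoidAway

end MonoidLocalizationFlat

/-! ### Coproducts and coequalizers of sheaves over `𝔽₁`, computed on sections. -/

section SheavesOverF1

lemma sheafHom_congr {C : Type (u + 1)} [LargeCategory.{u} C] {J : GrothendieckTopology Cᵒᵖ}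
    {X Y : Sheaf J (Type (u + 1))} {f g : X ⟶ Y} (h : f = g) (T : (Cᵒᵖ)ᵒᵖ) (x : X.obj.obj T) :
    f.hom.app T x = g.hom.app T x := by rw [h]

lemma isSheaf_overF1 (P : AffPresheaf CommMonCat.{u}) :
    Presheaf.IsSheaf overF1.{u}.zariskiTopology P := by
  rw [zariskiTopology_overF1_eq_bot]
  exact Presheaf.isSheaf_bot P

/-- As a consequence, taking sections on an affine scheme preserves colimits of sheaves. -/
instance isEquivalence_sheafToPresheaf_overF1 :
    (sheafToPresheaf overF1.{u}.zariskiTopology (Type (u + 1))).IsEquivalence where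
  essSurj := ⟨fun P => ⟨⟨P, isSheaf_overF1 P⟩, ⟨Iso.refl P⟩⟩⟩

instance isIso_toSheafify_overF1 (P : AffPresheaf CommMonCat.{u}) :
    IsIso (toSheafify overF1.{u}.zariskiTopology P) :=
  isIso_toSheafify _ (isSheaf_overF1 P)

/-- The functor of sections of sheaves over `𝔽₁` on an affine scheme. -/
abbrev sectionsF1 (T : (CommMonCat.{u}ᵒᵖ)ᵒᵖ) : overF1.{u}.Sh ⥤ Type (u + 1) :=
  sheafToPresheaf _ _ ⋙ (evaluation _ _).obj T

variable {ι : Type u} (F : ι → overF1.{u}.Sh) (T : (CommMonCat.{u}ᵒᵖ)ᵒᵖ)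

/-- Sections of a coproduct of sheaves over `𝔽₁` form the coproduct of the sections. -/
def isColimitSectionsSigma : IsColimit (Cofan.mk ((∐ F).obj.obj T)
    fun i => (Limits.Sigma.ι F i).hom.app T) :=
  isColimitCofanMkObjOfIsColimit (sectionsF1 T) F _ (coproductIsCoproduct F)

lemma exists_sigma_ι (x : (∐ F).obj.obj T) :
    ∃ (i : ι) (y : (F i).obj.obj T), (Limits.Sigma.ι F i).hom.app T y = x :=
  Cofan.inj_jointly_surjective_of_isColimit (isColimitSectionsSigma F T) x

lemma sigma_ι_injective (i : ι) : Function.Injective ((Limits.Sigma.ι F i).hom.app T) :=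
  Cofan.inj_injective_of_isColimit (isColimitSectionsSigma F T) i

lemma eq_of_sigma_ι_eq {i j : ι} (x : (F i).obj.obj T) (y : (F j).obj.obj T)
    (h : (Limits.Sigma.ι F i).hom.app T x = (Limits.Sigma.ι F j).hom.app T y) : i = j :=
  Cofan.eq_of_inj_apply_eq_of_isColimit (isColimitSectionsSigma F T) x y h

variable {X Y : overF1.{u}.Sh} (f g : X ⟶ Y)

/-- Sections of a coequalizer of sheaves over `𝔽₁` form the coequalizer of the sections. -/
def isColimitSectionsCoequalizer : IsColimit (Cofork.ofπ ((coequalizer.π f g).hom.app T)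
    (show f.hom.app T ≫ _ = g.hom.app T ≫ _ from
      congrArg (fun k => k.hom.app T) (coequalizer.condition f g))) :=
  isColimitCoforkMapOfIsColimit (sectionsF1 T) _ (coequalizerIsCoequalizer f g)

lemma coequalizer_π_surjective : Function.Surjective ((coequalizer.π f g).hom.app T) := by
  rw [← epi_iff_surjective]
  exact epi_of_isColimit_cofork (isColimitSectionsCoequalizer T f g)

lemma coequalizer_π_eq_iff
    (hfg : Equivalence fun x y : Y.obj.obj T => ∃ r, f.hom.app T r = x ∧ g.hom.app T r = y)
    (x y : Y.obj.obj T) : (coequalizer.π f g).hom.app T x = (coequalizer.π f g).hom.app T y ↔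
      ∃ r, f.hom.app T r = x ∧ g.hom.app T r = y := by
  constructor
  · intro h
    -- The equivalence class of `x` is a saturated subset, hence the full preimage of its image in
    -- the coequalizer.
    have := Types.coequalizer_preimage_image_eq_of_preimage_eq _ _ _ _
      (isColimitSectionsCoequalizer T f g)
      {y | ∃ r, f.hom.app T r = x ∧ g.hom.app T r = y} (by
        ext r
        exact ⟨fun h => hfg.trans h ⟨r, rfl, rfl⟩,
          fun h => hfg.trans h (hfg.symm ⟨r, rfl, rfl⟩)⟩)
    exact this.subset ⟨x, hfg.refl x, h⟩
  · rintro ⟨r, rfl, rfl⟩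
    exact sheafHom_congr (coequalizer.condition f g) T r

end SheavesOverF1

/-! ### The equivalence relation `R`, its quotient and the charts over `𝔽₁`. -/

section ToricCharts

variable {N : Type u} [AddCommGroup N]

lemma CutsOut.isMonoidAway {m : Module.Dual ℤ N} {τ σ : PointedCone ℝ (RealSpan N)}
    (hσ : IsRationalPolyhedral σ) (h : CutsOut m τ σ) :
    IsMonoidAway (coneMonoidMap h.le) (toConeMonoid h.1) where
  isUnit := h.isUnit
  surj := h.exists_mul_pow hσ
  exists_of_eq e := ⟨0, by rw [coneMonoidMap_injective _ e]⟩

lemma coneMonoidMap_comp {ρ τ σ : PointedCone ℝ (RealSpan N)} (h : ρ ≤ τ) (h' : τ ≤ σ) :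
    coneMonoidMap h' ≫ coneMonoidMap h = coneMonoidMap (h.trans h') := rfl

/-- The point of `U_σ` with values in `D` given by a morphism `M_σ ⟶ D`. -/
def toricPoint {σ : PointedCone ℝ (RealSpan N)} {D : CommMonCat.{u}} (f : coneMonoid σ ⟶ D) :
    (toricU σ).obj.obj (op (op D)) :=
  (toSheafify overF1.zariskiTopology (rep (coneMonoid σ))).app (op (op D)) ⟨f.op⟩

variable {τ σ : PointedCone ℝ (RealSpan N)} {D D' : CommMonCat.{u}}

lemma toricPoint_injective {f g : coneMonoid σ ⟶ D} (h : toricPoint f = toricPoint g) : f = g := by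
  have h1 := (ConcreteCategory.bijective_of_isIso
    ((toSheafify overF1.zariskiTopology (rep (coneMonoid σ))).app (op (op D)))).1 h
  exact Quiver.Hom.op_inj (congrArg ULift.down h1)

lemma toricPoint_surjective (y : (toricU σ).obj.obj (op (op D))) :
    ∃ f : coneMonoid σ ⟶ D, toricPoint f = y := by
  obtain ⟨⟨f⟩, hf⟩ := (ConcreteCategory.bijective_of_isIso
    ((toSheafify overF1.zariskiTopology (rep (coneMonoid σ))).app (op (op D)))).2 y
  exact ⟨f.unop, hf⟩

lemma toricUMap_toricPoint (h : τ ≤ σ) (f : coneMonoid τ ⟶ D) :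
    (toricUMap h).hom.app _ (toricPoint f) = toricPoint (coneMonoidMap h ≫ f) := by
  have := toSheafify_naturality overF1.zariskiTopology
    (uliftYoneda.{u + 1}.map (coneMonoidMap h).op)
  exact (ConcreteCategory.congr_hom (congrArg (fun k => k.app (op (op D))) this) ⟨f.op⟩).symm

lemma toricPoint_map (f : coneMonoid σ ⟶ D) (a : D ⟶ D') :
    (toricU σ).obj.map a.op.op (toricPoint f) = toricPoint (f ≫ a) :=
  (ConcreteCategory.congr_hom ((toSheafify overF1.zariskiTopology
    (rep (coneMonoid σ))).naturality a.op.op) ⟨f.op⟩).symm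

variable (Δ : Fan N)

/-- The point of `X = ∐ U_σ` given by a cone `σ` and a morphism `M_σ ⟶ D`. -/
def toricXPoint (σ : Δ.cones) (f : coneMonoid σ.1 ⟶ D) : (toricX Δ).obj.obj (op (op D)) :=
  (Limits.Sigma.ι (fun σ : Δ.cones => toricU σ.1) σ).hom.app _ (toricPoint f)

/-- The point of `R = ∐ U_{σ ∩ σ'}` given by a morphism `M_{σ ∩ σ'} ⟶ D`. -/
def toricRPoint (σ σ' : Δ.cones) (f : coneMonoid (σ.1 ⊓ σ'.1) ⟶ D) :
    (toricR Δ).obj.obj (op (op D)) :=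
  (Limits.Sigma.ι (fun p : Δ.cones × Δ.cones => toricU (p.1.1 ⊓ p.2.1)) (σ, σ')).hom.app _
    (toricPoint f)

lemma exists_toricXPoint (x : (toricX Δ).obj.obj (op (op D))) :
    ∃ (σ : Δ.cones) (f : coneMonoid σ.1 ⟶ D), toricXPoint Δ σ f = x := by
  obtain ⟨σ, y, rfl⟩ := exists_sigma_ι _ _ x
  obtain ⟨f, rfl⟩ := toricPoint_surjective y
  exact ⟨σ, f, rfl⟩

lemma exists_toricRPoint (x : (toricR Δ).obj.obj (op (op D))) :
    ∃ (σ σ' : Δ.cones) (f : coneMonoid (σ.1 ⊓ σ'.1) ⟶ D), toricRPoint Δ σ σ' f = x := by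
  obtain ⟨⟨σ, σ'⟩, y, rfl⟩ := exists_sigma_ι _ _ x
  obtain ⟨f, rfl⟩ := toricPoint_surjective y
  exact ⟨σ, σ', f, rfl⟩

variable {Δ}

lemma toricXPoint_injective {σ : Δ.cones} {f g : coneMonoid σ.1 ⟶ D}
    (h : toricXPoint Δ σ f = toricXPoint Δ σ g) : f = g :=
  toricPoint_injective (sigma_ι_injective (fun σ : Δ.cones => toricU σ.1) _ σ h)

lemma eq_of_toricXPoint_eq {σ σ' : Δ.cones} {f : coneMonoid σ.1 ⟶ D} {g : coneMonoid σ'.1 ⟶ D}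
    (h : toricXPoint Δ σ f = toricXPoint Δ σ' g) : σ = σ' :=
  eq_of_sigma_ι_eq _ _ _ _ h

lemma toricFst_toricRPoint (σ σ' : Δ.cones) (f : coneMonoid (σ.1 ⊓ σ'.1) ⟶ D) :
    (toricFst Δ).hom.app _ (toricRPoint Δ σ σ' f) =
      toricXPoint Δ σ (coneMonoidMap inf_le_left ≫ f) := by
  have h : Limits.Sigma.ι (fun p : Δ.cones × Δ.cones => toricU (p.1.1 ⊓ p.2.1)) (σ, σ') ≫
      toricFst Δ = toricUMap inf_le_left ≫ Limits.Sigma.ι (fun σ : Δ.cones => toricU σ.1) σ :=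
    Limits.Sigma.ι_desc _ _
  refine (sheafHom_congr h _ (toricPoint f)).trans ?_
  rw [toricXPoint, ← toricUMap_toricPoint]
  rfl

lemma toricSnd_toricRPoint (σ σ' : Δ.cones) (f : coneMonoid (σ.1 ⊓ σ'.1) ⟶ D) :
    (toricSnd Δ).hom.app _ (toricRPoint Δ σ σ' f) =
      toricXPoint Δ σ' (coneMonoidMap inf_le_right ≫ f) := by
  have h : Limits.Sigma.ι (fun p : Δ.cones × Δ.cones => toricU (p.1.1 ⊓ p.2.1)) (σ, σ') ≫
      toricSnd Δ = toricUMap inf_le_right ≫ Limits.Sigma.ι (fun σ : Δ.cones => toricU σ.1) σ' :=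
    Limits.Sigma.ι_desc _ _
  refine (sheafHom_congr h _ (toricPoint f)).trans ?_
  rw [toricXPoint, ← toricUMap_toricPoint]
  rfl

lemma toricChart_toricPoint (σ : Δ.cones) (f : coneMonoid σ.1 ⟶ D) :
    (toricChart Δ σ).hom.app _ (toricPoint f) =
      (coequalizer.π (toricFst Δ) (toricSnd Δ)).hom.app _ (toricXPoint Δ σ f) := rfl

lemma exists_toricChart (y : (toricF1 Δ).obj.obj (op (op D))) :
    ∃ (σ : Δ.cones) (f : coneMonoid σ.1 ⟶ D), (toricChart Δ σ).hom.app _ (toricPoint f) = y := by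
  obtain ⟨x, rfl⟩ := coequalizer_π_surjective _ _ _ y
  obtain ⟨σ, f, rfl⟩ := exists_toricXPoint Δ x
  exact ⟨σ, f, rfl⟩

/-- Morphisms `M_σ ⟶ D` and `M_σ' ⟶ D` that agree on the common localization `M_{σ ∩ σ'}`. -/
def AgreeOnInf {σ σ' : PointedCone ℝ (RealSpan N)} (f : coneMonoid σ ⟶ D)
    (f' : coneMonoid σ' ⟶ D) : Prop :=
  ∃ g : coneMonoid (σ ⊓ σ') ⟶ D,
    coneMonoidMap inf_le_left ≫ g = f ∧ coneMonoidMap inf_le_right ≫ g = f'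

/-- The summands of the coproduct `X` are disjoint, so a point of `R` over the charts of `σ` and
`σ'` can only come from the summand indexed by `(σ, σ')`. -/
lemma exists_toricRPoint_iff {σ σ' : Δ.cones} {f : coneMonoid σ.1 ⟶ D}
    {f' : coneMonoid σ'.1 ⟶ D} :
    (∃ r : (toricR Δ).obj.obj (op (op D)), (toricFst Δ).hom.app _ r = toricXPoint Δ σ f ∧
      (toricSnd Δ).hom.app _ r = toricXPoint Δ σ' f') ↔ AgreeOnInf f f' := by
  constructor
  · rintro ⟨r, h1, h2⟩
    obtain ⟨σ₁, σ₂, g, rfl⟩ := exists_toricRPoint Δ r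
    rw [toricFst_toricRPoint] at h1
    rw [toricSnd_toricRPoint] at h2
    obtain rfl := eq_of_toricXPoint_eq h1
    obtain rfl := eq_of_toricXPoint_eq h2
    exact ⟨g, toricXPoint_injective h1, toricXPoint_injective h2⟩
  · rintro ⟨g, rfl, rfl⟩
    exact ⟨toricRPoint Δ σ σ' g, toricFst_toricRPoint _ _ _, toricSnd_toricRPoint _ _ _⟩

lemma toricChartRep_app (σ : Δ.cones) (f : coneMonoid σ.1 ⟶ D) :
    (toricChartRep Δ σ).app (op (op D)) ⟨f.op⟩ = (toricChart Δ σ).hom.app _ (toricPoint f) := rfl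

variable [Module.Free ℤ N] [Module.Finite ℤ N]

lemma IsFace.isMonoidAway (hσ : IsRationalPolyhedral σ) (h : IsFace τ σ) :
    ∃ m, IsMonoidAway (coneMonoidMap h.le) m := by
  obtain ⟨m, hm⟩ := exists_cutsOut hσ h
  exact ⟨_, hm.isMonoidAway hσ⟩

instance epi_coneMonoidMap_inf_left (σ σ' : Δ.cones) :
    Epi (coneMonoidMap (inf_le_left : σ.1 ⊓ σ'.1 ≤ σ.1)) := by
  obtain ⟨m, hm⟩ := (Δ.inf_isFace_left _ σ.2 _ σ'.2).isMonoidAway (Δ.rational _ σ.2)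
  exact hm.epi

/-- The two projections determine the index `(σ₁, σ₂)` by disjointness; then the first alone
determines the point, because `M_σ₁ ⟶ M_{σ₁ ∩ σ₂}` is an epimorphism. -/
lemma toricFst_toricSnd_injective (T : (CommMonCat.{u}ᵒᵖ)ᵒᵖ) :
    Function.Injective (fun r : (toricR Δ).obj.obj T =>
      ((toricFst Δ).hom.app T r, (toricSnd Δ).hom.app T r)) := by
  intro r r' h
  obtain ⟨σ₁, σ₂, f, rfl⟩ := exists_toricRPoint (D := T.unop.unop) Δ r
  obtain ⟨σ₁', σ₂', f', rfl⟩ := exists_toricRPoint (D := T.unop.unop) Δ r'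
  have h1 := (toricFst_toricRPoint σ₁ σ₂ f).symm.trans
    ((congrArg Prod.fst h).trans (toricFst_toricRPoint σ₁' σ₂' f'))
  have h2 := (toricSnd_toricRPoint σ₁ σ₂ f).symm.trans
    ((congrArg Prod.snd h).trans (toricSnd_toricRPoint σ₁' σ₂' f'))
  obtain rfl := eq_of_toricXPoint_eq h1
  obtain rfl := eq_of_toricXPoint_eq h2
  rw [(cancel_epi _).1 (toricXPoint_injective h1)]

/-- The morphism `f₂` inverts the forms `m₁` and `m₃` that cut `σ₁ ∩ σ₂` and `σ₂ ∩ σ₃` out of `σ₂`,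
hence also `m₁ + m₃`, which cuts out the triple intersection. It thus extends to the monoid of the
triple intersection, and the extension is restricted to `M_{σ₁ ∩ σ₃}`. -/
lemma AgreeOnInf.trans {σ₁ σ₂ σ₃ : Δ.cones} {f₁ : coneMonoid σ₁.1 ⟶ D} {f₂ : coneMonoid σ₂.1 ⟶ D}
    {f₃ : coneMonoid σ₃.1 ⟶ D} (h : AgreeOnInf f₁ f₂) (h' : AgreeOnInf f₂ f₃) :
    AgreeOnInf f₁ f₃ := by
  obtain ⟨g, rfl, hg⟩ := h
  obtain ⟨g', hg', rfl⟩ := h'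
  obtain ⟨m₁, hm₁⟩ := exists_cutsOut (Δ.rational _ σ₂.2) (Δ.inf_isFace_right _ σ₁.2 _ σ₂.2)
  obtain ⟨m₃, hm₃⟩ := exists_cutsOut (Δ.rational _ σ₂.2) (Δ.inf_isFace_left _ σ₂.2 _ σ₃.2)
  have hm := hm₁.inf hm₃
  have hu : IsUnit (f₂.hom (toConeMonoid hm.1)) := by
    have e : toConeMonoid hm.1 = toConeMonoid hm₁.1 * toConeMonoid hm₃.1 := rfl
    rw [e, map_mul]
    refine IsUnit.mul ?_ ?_
    · rw [← hg]
      exact hm₁.isUnit.map g.hom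
    · rw [← hg']
      exact hm₃.isUnit.map g'.hom
  obtain ⟨k, hk⟩ := (hm.isMonoidAway (Δ.rational _ σ₂.2)).exists_lift f₂ hu
  -- Both sides extend `f₂`, and `M_σ₂ ⟶ M_{σ₁ ∩ σ₂}` is an epimorphism; `e2` is the same on the
  -- side of `σ₃`.
  have e1 : coneMonoidMap inf_le_left ≫ k = g := by
    have := (hm₁.isMonoidAway (Δ.rational _ σ₂.2)).epi
    rw [← cancel_epi (coneMonoidMap hm₁.le), ← Category.assoc, coneMonoidMap_comp]
    exact hk.trans hg.symm
  have e2 : coneMonoidMap inf_le_right ≫ k = g' := by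
    have := (hm₃.isMonoidAway (Δ.rational _ σ₂.2)).epi
    rw [← cancel_epi (coneMonoidMap hm₃.le), ← Category.assoc, coneMonoidMap_comp]
    exact hk.trans hg'.symm
  refine ⟨coneMonoidMap (le_inf (inf_le_left.trans inf_le_left)
    (inf_le_right.trans inf_le_right)) ≫ k, ?_, ?_⟩
  · rw [← e1]
    rfl
  · rw [← e2]
    rfl

variable (Δ) in
lemma toricR_equivalence (T : (CommMonCat.{u}ᵒᵖ)ᵒᵖ) :
    Equivalence (fun x y : (toricX Δ).obj.obj T =>
      ∃ r : (toricR Δ).obj.obj T,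
        (toricFst Δ).hom.app T r = x ∧ (toricSnd Δ).hom.app T r = y) := by
  refine ⟨fun x => ?_, fun {x y} h => ?_, fun {x y z} h h' => ?_⟩
  · obtain ⟨σ, f, rfl⟩ := exists_toricXPoint (D := T.unop.unop) Δ x
    exact exists_toricRPoint_iff.2 ⟨coneMonoidMap (le_inf le_rfl le_rfl) ≫ f, rfl, rfl⟩
  · obtain ⟨σ, f, rfl⟩ := exists_toricXPoint (D := T.unop.unop) Δ x
    obtain ⟨σ', f', rfl⟩ := exists_toricXPoint (D := T.unop.unop) Δ y
    obtain ⟨g, hg, hg'⟩ := exists_toricRPoint_iff.1 h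
    refine exists_toricRPoint_iff.2 ⟨coneMonoidMap (le_inf inf_le_right inf_le_left) ≫ g, ?_, ?_⟩
    · rw [← hg']
      rfl
    · rw [← hg]
      rfl
  · obtain ⟨σ₁, f₁, rfl⟩ := exists_toricXPoint (D := T.unop.unop) Δ x
    obtain ⟨σ₂, f₂, rfl⟩ := exists_toricXPoint (D := T.unop.unop) Δ y
    obtain ⟨σ₃, f₃, rfl⟩ := exists_toricXPoint (D := T.unop.unop) Δ z
    exact exists_toricRPoint_iff.2
      ((exists_toricRPoint_iff.1 h).trans (exists_toricRPoint_iff.1 h'))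

/-- Since `R` is already an equivalence relation on sections, no chain of intermediate charts is
needed. -/
lemma toricChart_eq_iff {σ σ' : Δ.cones} {f : coneMonoid σ.1 ⟶ D} {f' : coneMonoid σ'.1 ⟶ D} :
    (toricChart Δ σ).hom.app _ (toricPoint f) = (toricChart Δ σ').hom.app _ (toricPoint f') ↔
      AgreeOnInf f f' := by
  rw [toricChart_toricPoint, toricChart_toricPoint, ← exists_toricRPoint_iff]
  exact coequalizer_π_eq_iff _ _ _ (toricR_equivalence Δ _) _ _

lemma isPullback_toricChart (σ σ' : Δ.cones) :
    IsPullback (toricUMap (inf_le_left : σ.1 ⊓ σ'.1 ≤ σ.1))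
      (toricUMap (inf_le_right : σ.1 ⊓ σ'.1 ≤ σ'.1)) (toricChart Δ σ) (toricChart Δ σ') := by
  have hw : toricUMap (inf_le_left : σ.1 ⊓ σ'.1 ≤ σ.1) ≫ toricChart Δ σ =
      toricUMap (inf_le_right : σ.1 ⊓ σ'.1 ≤ σ'.1) ≫ toricChart Δ σ' := by
    ext T x
    obtain ⟨f, rfl⟩ := toricPoint_surjective (D := T.unop.unop) x
    change (toricChart Δ σ).hom.app T ((toricUMap _).hom.app T (toricPoint f)) =
      (toricChart Δ σ').hom.app T ((toricUMap _).hom.app T (toricPoint f))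
    rw [toricUMap_toricPoint, toricUMap_toricPoint]
    exact toricChart_eq_iff.2 ⟨f, rfl, rfl⟩
  refine IsPullback.of_map (sheafToPresheaf _ _) hw (IsPullback.of_forall_isPullback_app
    fun T => (Types.isPullback_iff _ _ _ _).2 ⟨?_, ?_, ?_⟩)
  · exact congrArg (fun k => k.hom.app T) hw
  · rintro x y ⟨h, -⟩
    obtain ⟨f, rfl⟩ := toricPoint_surjective (D := T.unop.unop) x
    obtain ⟨g, rfl⟩ := toricPoint_surjective (D := T.unop.unop) y
    have h1 := (toricUMap_toricPoint _ _).symm.trans (h.trans (toricUMap_toricPoint _ _))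
    rw [(cancel_epi _).1 (toricPoint_injective h1)]
  · intro x y h
    obtain ⟨f, rfl⟩ := toricPoint_surjective (D := T.unop.unop) x
    obtain ⟨g, rfl⟩ := toricPoint_surjective (D := T.unop.unop) y
    obtain ⟨k, rfl, rfl⟩ := toricChart_eq_iff.1 h
    exact ⟨toricPoint k, toricUMap_toricPoint _ _, toricUMap_toricPoint _ _⟩

lemma toricChart_injective (σ : Δ.cones) (T : (CommMonCat.{u}ᵒᵖ)ᵒᵖ) :
    Function.Injective ((toricChart Δ σ).hom.app T) := by
  intro x y h
  obtain ⟨f, rfl⟩ := toricPoint_surjective (D := T.unop.unop) x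
  obtain ⟨g, rfl⟩ := toricPoint_surjective (D := T.unop.unop) y
  obtain ⟨k, hk, hk'⟩ := toricChart_eq_iff.1 h
  rw [← hk, ← hk']

variable (Δ) in
-- Let `m` cut `σ ∩ σ'` out of `σ'`. Over a point `f : M_σ' ⟶ A` the chart of `σ` pulls back to the
-- locus where `f m` is invertible, so the single localization `A[1 / f m]` presents it.
lemma isAffineCovering_toricChartRep : overF1.IsAffineCovering (toricChartRep Δ) where
  isOpenImmersion σ :=
    { injective := fun T => by
        rintro ⟨f⟩ ⟨g⟩ h
        exact congrArg (fun k => ULift.up (Quiver.Hom.op k))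
          (toricPoint_injective (toricChart_injective σ T h))
      image := fun A x => by
        obtain ⟨σ', f, rfl⟩ := exists_toricChart x
        obtain ⟨m, hm⟩ := exists_cutsOut (Δ.rational _ σ'.2) (Δ.inf_isFace_right _ σ.2 _ σ'.2)
        have hloc := IsMonoidAway.localization A (f.hom (toConeMonoid hm.1))
        refine ⟨PUnit, fun _ => CommMonCat.of _, fun _ => _, fun _ => hloc.isZariskiOpen,
          fun D a => ?_⟩
        have key : (toricF1 Δ).obj.map a.op.op ((toricChart Δ σ').hom.app _ (toricPoint f)) ∈
            Set.range ((toricChartRep Δ σ).app (op (op D))) ↔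
            IsUnit ((f ≫ a).hom (toConeMonoid hm.1)) := by
          have e : (toricF1 Δ).obj.map a.op.op ((toricChart Δ σ').hom.app _ (toricPoint f)) =
              (toricChart Δ σ').hom.app _ (toricPoint (f ≫ a)) := by
            rw [← toricPoint_map]
            exact (ConcreteCategory.congr_hom ((toricChart Δ σ').hom.naturality a.op.op) _).symm
          rw [e]
          constructor
          · rintro ⟨⟨g⟩, hg⟩
            obtain ⟨k, -, hk⟩ := toricChart_eq_iff.1
              ((toricChartRep_app (D := D) σ g.unop).symm.trans hg)
            rw [← hk]
            exact hm.isUnit.map k.hom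
          · intro hu
            obtain ⟨k, hk⟩ := (hm.isMonoidAway (Δ.rational _ σ'.2)).exists_lift _ hu
            exact ⟨⟨(coneMonoidMap inf_le_left ≫ k).op⟩,
              (toricChartRep_app σ _).trans (toricChart_eq_iff.2 ⟨k, rfl, hk⟩)⟩
        rw [key]
        constructor
        · intro hu
          refine ⟨⊤, GrothendieckTopology.top_mem _ _, fun D' d _ => ⟨⟨⟩, ?_⟩⟩
          exact hloc.exists_lift (a ≫ d) (hu.map d.hom)
        · rintro ⟨S, hS, h⟩
          -- In the trivial topology, factoring locally means factoring over `D` itself.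
          rw [zariskiTopology_overF1_eq_bot, GrothendieckTopology.bot_covering] at hS
          obtain ⟨_, b, hb⟩ := h (𝟙 D) (by rw [hS]; trivial)
          rw [Category.comp_id] at hb
          rw [← hb]
          exact hloc.isUnit.map b.hom }
  epi D y := by
    obtain ⟨σ, f, rfl⟩ := exists_toricChart y
    refine ⟨⊤, GrothendieckTopology.top_mem _ _, fun D' d _ => ⟨σ, ⟨(f ≫ d).op⟩, ?_⟩⟩
    rw [toricChartRep_app, ← toricPoint_map]
    exact ConcreteCategory.congr_hom ((toricChart Δ σ).hom.naturality d.op.op) _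

end ToricCharts

/-! ### Zariski coverings over `ℤ` and fpqc descent for functors of points. -/

section ZariskiOverZ

open AlgebraicGeometry

variable {R S : CommRingCat.{u}}

lemma flat_of_preservesFiniteLimits (φ : R ⟶ S)
    [PreservesFiniteLimits (ModuleCat.extendScalars.{u, u, u} φ.hom)] : φ.hom.Flat := by
  let := φ.hom.toAlgebra
  change Module.Flat R S
  rw [Module.Flat.iff_lTensor_preserves_injective_linearMap'.{u}]
  intro M M' _ _ _ _ f hf
  have h1 : Mono (ModuleCat.ofHom f) := (ModuleCat.mono_iff_injective _).2 hf
  have h2 : Mono ((ModuleCat.extendScalars.{u, u, u} φ.hom).map (ModuleCat.ofHom f)) :=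
    inferInstance
  exact (ModuleCat.mono_iff_injective _).1 h2

lemma isZariskiOpen_overZ_of_flat (φ : R ⟶ S) (hflat : φ.hom.Flat) (hepi : Epi φ)
    (hfp : IsFinitelyPresentable.{u} (Under.mk φ)) : overZ.{u}.IsZariskiOpen φ :=
  ⟨ModuleCat.preservesFiniteLimits_extendScalars_of_flat hflat, hepi, hfp⟩

/-- The localization `R ⟶ R[1/r]`. -/
abbrev awayMap (R : CommRingCat.{u}) (r : R) : R ⟶ CommRingCat.of (Localization.Away r) :=
  CommRingCat.ofHom (algebraMap R (Localization.Away r))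

lemma isZariskiOpen_awayMap (r : R) : overZ.{u}.IsZariskiOpen (awayMap R r) := by
  refine isZariskiOpen_overZ_of_flat _ ?_ ?_ ?_
  · exact (RingHom.flat_algebraMap_iff).2 (IsLocalization.flat _ (Submonoid.powers r))
  · constructor
    intro T f g h
    ext1
    exact IsLocalization.ringHom_ext (Submonoid.powers r) (congrArg CommRingCat.Hom.hom h)
  · refine CommRingCat.isFinitelyPresentable_under R (Under.mk (awayMap R r)) ?_
    exact (RingHom.finitePresentation_algebraMap (A := R) (B := Localization.Away r)).2 (IsLocalization.Away.finitePresentation r)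

lemma isIso_of_span_eq_top {s : Set R} (hs : Ideal.span s = ⊤) {M M' : ModuleCat.{u} R}
    (v : M ⟶ M')
    (h : ∀ r ∈ s, IsIso ((ModuleCat.extendScalars.{u, u, u} (awayMap R r).hom).map v)) :
    IsIso v := by
  rw [ConcreteCategory.isIso_iff_bijective]
  refine bijective_of_isLocalized_span s hs
    (fun r : s => Localization.Away r.1 ⊗[R] M) (fun r => TensorProduct.mk R _ M 1)
    (fun r : s => Localization.Away r.1 ⊗[R] M') (fun r => TensorProduct.mk R _ M' 1) v.hom ?_
  intro r
  have h1 := h r.1 r.2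
  rw [ConcreteCategory.isIso_iff_bijective] at h1
  have h2 : IsLocalizedModule.map (Submonoid.powers r.1) (TensorProduct.mk R _ M 1)
      (TensorProduct.mk R (Localization.Away r.1) M' 1) v.hom =
      v.hom.lTensor (Localization.Away r.1) := by
    refine IsLocalizedModule.linearMap_ext (Submonoid.powers r.1)
      (TensorProduct.mk R (Localization.Away r.1) M 1)
      (TensorProduct.mk R (Localization.Away r.1) M' 1) ?_
    ext x
    rw [LinearMap.comp_apply, IsLocalizedModule.map_apply]
    rfl
  rw [h2]
  have h3 : ∀ i : Algebra R (Localization.Away r.1), i = (awayMap R r.1).hom.toAlgebra →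
      Function.Bijective (@LinearMap.lTensor R _ (Localization.Away r.1) M M' _ _ _ i.toModule
        _ _ v.hom) := by
    rintro _ rfl
    exact h1
  exact h3 _ (Algebra.algebra_ext _ _ fun _ => rfl)

/-- Sieves containing the localizations at generators of the unit ideal are Zariski coverings. -/
lemma mem_zariskiTopology_of_span_eq_top {s : Set R} (hs : Ideal.span s = ⊤) (S : Sieve (op R))
    (hS : ∀ r ∈ s, S (awayMap R r).op) : S ∈ overZ.{u}.zariskiTopology (op R) := by
  -- Writing `1` as a combination of elements of `s` uses only finitely many of them; these give the
  -- finite conservative family that a covering requires.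
  obtain ⟨t, hts, ht⟩ := (Submodule.mem_span_finite_of_mem_span
    (show (1 : R) ∈ Ideal.span s by rw [hs]; trivial))
  have ht' : Ideal.span (t : Set R) = ⊤ := (Ideal.eq_top_iff_one _).2 ht
  let e := t.equivFin.symm
  let P : Presieve (op R) := Presieve.ofArrows (fun i => op (CommRingCat.of
    (Localization.Away (e i).1))) (fun i => (awayMap R (e i).1).op)
  refine GrothendieckTopology.superset_covering _ ?_
    (Precoverage.generate_mem_toGrothendieck (R := P) ⟨?_, t.card, _, fun i => awayMap R (e i).1,
      fun i => ⟨i⟩, ?_⟩)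
  · rw [Sieve.generate_le_iff]
    rintro _ _ ⟨i⟩
    exact hS _ (hts (e i).2)
  · rintro _ _ ⟨i⟩
    exact isZariskiOpen_awayMap _
  · intro M M' v hv
    refine isIso_of_span_eq_top ht' (M := M) (M' := M') v fun r hr => ?_
    obtain ⟨i, hi⟩ := e.surjective ⟨r, hr⟩
    obtain rfl : (e i).1 = r := congrArg Subtype.val hi
    exact hv i

/-- If all the `Spec (B i)` missed `p`, every `B i ⊗ κ(p)` would vanish, and `0 → κ(p)` would become
an isomorphism after each extension without being one. -/
lemma exists_mem_range_comap {n : ℕ} {B : Fin n → CommRingCat.{u}} (φ : ∀ i, R ⟶ B i)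
    (h : ∀ ⦃M M' : ModuleCat.{u} R⦄ (v : M ⟶ M'),
      (∀ i, IsIso ((ModuleCat.extendScalars.{u, u, u} (φ i).hom).map v)) → IsIso v)
    (p : PrimeSpectrum R) : ∃ i, p ∈ Set.range (PrimeSpectrum.comap (φ i).hom) := by
  by_contra! hp
  let v : ModuleCat.of R PUnit.{u + 1} ⟶ ModuleCat.of R p.asIdeal.ResidueField :=
    ModuleCat.ofHom 0
  have hv : IsIso v := h v fun i => by
    let := (φ i).hom.toAlgebra
    have h1 := hp i
    have h2 := (PrimeSpectrum.nontrivial_iff_mem_rangeComap (S := B i) p).not.2 h1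
    rw [not_nontrivial_iff_subsingleton] at h2
    have h3 : Subsingleton (B i ⊗[R] p.asIdeal.ResidueField) :=
      (TensorProduct.comm R (B i) p.asIdeal.ResidueField).toEquiv.subsingleton
    have h4 : Subsingleton (B i ⊗[R] PUnit.{u + 1}) := inferInstance
    rw [ConcreteCategory.isIso_iff_bijective]
    exact ⟨fun x y _ => h4.elim x y, fun y => ⟨0, h3.elim _ _⟩⟩
  rw [ConcreteCategory.isIso_iff_bijective] at hv
  obtain ⟨x, hx⟩ := hv.2 (1 : p.asIdeal.ResidueField)
  exact zero_ne_one hx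

lemma ofArrows_mem_propQCPrecoverage (P : MorphismProperty Scheme.{u}) {n : ℕ}
    {B : Fin n → CommRingCat.{u}} (φ : ∀ i, R ⟶ B i) (hφ : ∀ i, P (Spec.map (φ i)))
    (h : ∀ p : PrimeSpectrum R, ∃ i, p ∈ Set.range (PrimeSpectrum.comap (φ i).hom)) :
    Presieve.ofArrows (fun i => Spec (B i)) (fun i => Spec.map (φ i)) ∈
      Scheme.propQCPrecoverage P (Spec R) := by
  let 𝒰 : Scheme.Cover.{u + 1} (Scheme.precoverage P) (Spec R) :=
    { I₀ := ULift.{u + 1} (Fin n)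
      X := fun i => Spec (B i.down)
      f := fun i => Spec.map (φ i.down)
      mem₀ := (Scheme.ofArrows_mem_precoverage_iff P).2
        ⟨fun x => ⟨⟨(h x).choose⟩, (h x).choose_spec⟩, fun i => hφ _⟩ }
  refine Scheme.mem_propQCPrecoverage_iff_exists_quasiCompactCover.2 ⟨𝒰, ?_, ?_⟩
  · have : Finite 𝒰.I₀ := inferInstanceAs (Finite (ULift.{u + 1} (Fin n)))
    have : ∀ i, QuasiCompact (𝒰.f i) := fun i =>
      inferInstanceAs (QuasiCompact (Spec.map (φ i.down)))
    exact QuasiCompactCover.of_finite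
  · refine le_antisymm ?_ ?_
    · rintro _ _ ⟨i⟩
      exact Presieve.ofArrows.mk (ULift.up.{u + 1} i)
    · rintro _ _ ⟨i⟩
      exact Presieve.ofArrows.mk i.down

/-- The fpqc topology on affine schemes. -/
def fpqcAffine : Precoverage CommRingCat.{u}ᵒᵖ := Scheme.fpqcPrecoverage.comap Scheme.Spec

/-- Flatness of the members and joint surjectivity of a finite subfamily are all that is used, so
the fpqc topology suffices and Zariski opens need not be identified with open immersions. -/
lemma zariskiTopology_overZ_le_fpqcAffine :
    overZ.{u}.zariskiTopology ≤ fpqcAffine.{u}.toGrothendieck := by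
  rw [ModuleTheory.zariskiTopology, Precoverage.toGrothendieck_eq_sInf]
  refine sInf_le ?_
  rintro X P ⟨hP, n, B, φ, hφ, hcons⟩
  let Q : Presieve X := Presieve.ofArrows (fun i => op (B i)) (fun i => (φ i).op)
  refine GrothendieckTopology.superset_covering _ (S := Sieve.generate Q) ?_
    (Precoverage.generate_mem_toGrothendieck ?_)
  · refine Sieve.generate_mono ?_
    rintro _ _ ⟨i⟩
    exact hφ i
  · rw [fpqcAffine, Precoverage.mem_comap_iff, Presieve.map_ofArrows]
    refine ofArrows_mem_propQCPrecoverage _ φ (fun i => ?_) (exists_mem_range_comap φ hcons)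
    have : PreservesFiniteLimits (ModuleCat.extendScalars.{u, u, u} (φ i).hom) :=
      (hP _ (hφ i)).flat
    exact (Flat.SpecMap_iff).2 (flat_of_preservesFiniteLimits _)

/-- The functor of points of a scheme is a Zariski sheaf. -/
lemma isSheaf_functorOfPoints (X : Scheme.{u}) :
    Presheaf.IsSheaf overZ.{u}.zariskiTopology (functorOfPoints X) := by
  have : Functor.IsContinuous Scheme.Spec fpqcAffine.{u}.toGrothendieck
      Scheme.fpqcPrecoverage.{u}.toGrothendieck := by
    have : fpqcAffine.{u}.IsStableUnderBaseChange :=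
      inferInstanceAs (Scheme.fpqcPrecoverage.comap Scheme.Spec).IsStableUnderBaseChange
    exact Functor.isContinuous_toGrothendieck_of_pullbacksPreservedBy _ _ _ le_rfl
  -- The fpqc topology is subcanonical: the sheaf represented by `X` restricts along `Spec` to an
  -- fpqc sheaf on affine schemes.
  have h := Scheme.Spec.op_comp_isSheaf fpqcAffine.{u}.toGrothendieck Scheme.fpqcTopology.{u}
    ((GrothendieckTopology.uliftYoneda.{u + 1} Scheme.fpqcTopology.{u}).obj X)
  exact fun E => Presieve.isSheaf_of_le _ zariskiTopology_overZ_le_fpqcAffine (h E)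

end ZariskiOverZ

/-! ### Base change of a semiring extension to a ring. -/

section SemiringBaseChange

/-- Tensoring an `R`-linear map with `R ⊗[A] B` is tensoring its restriction to `A` with `B`. -/
lemma exists_equiv_lTensor_baseChange (A R B M M' : Type u) [CommSemiring A] [CommSemiring R]
    [CommSemiring B] [Algebra A R] [Algebra A B] [AddCommMonoid M] [AddCommMonoid M']
    [Module R M] [Module R M'] [Module A M] [Module A M'] [IsScalarTower A R M]
    [IsScalarTower A R M'] (f : M →ₗ[R] M') :
    ∃ (e : (R ⊗[A] B) ⊗[R] M ≃ B ⊗[A] M) (e' : (R ⊗[A] B) ⊗[R] M' ≃ B ⊗[A] M'),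
      e' ∘ f.lTensor (R ⊗[A] B) = (f.restrictScalars A).lTensor B ∘ e := by
  let E : ∀ (L : Type u) [AddCommMonoid L] [Module R L] [Module A L] [IsScalarTower A R L],
      (R ⊗[A] B) ⊗[R] L ≃+ B ⊗[A] L := fun L _ _ _ _ =>
    (TensorProduct.comm R (R ⊗[A] B) L).toAddEquiv.trans
      ((TensorProduct.AlgebraTensorModule.cancelBaseChange A R R L B).toAddEquiv.trans
        (TensorProduct.comm A L B).toAddEquiv)
  refine ⟨(E M).toEquiv, (E M').toEquiv, funext fun x => ?_⟩
  change E M' (f.lTensor (R ⊗[A] B) x) = (f.restrictScalars A).lTensor B (E M x)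
  induction x using TensorProduct.induction_on with
  | zero => simp only [map_zero]
  | add x y hx hy => rw [map_add, map_add, hx, hy, map_add, map_add]
  | tmul t m =>
    induction t using TensorProduct.induction_on with
    | zero => simp only [map_zero, TensorProduct.zero_tmul]
    | add x y hx hy => rw [TensorProduct.add_tmul, map_add, map_add, hx, hy, map_add, map_add]
    | tmul r b =>
      change b ⊗ₜ[A] (r • f m) = b ⊗ₜ[A] f (r • m)
      rw [map_smul]

/-- Elements of `M` are morphisms to `M` from the free semimodule of rank one. -/
lemma SemimoduleCat.injective_of_mono {A : CommSemiRingCat.{u}} {M M' : SemimoduleCat.{u} A}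
    (f : M ⟶ M') [Mono f] : Function.Injective f.hom := by
  intro x y hxy
  let g : M → (SemimoduleCat.of A A ⟶ M) := fun x =>
    SemimoduleCat.ofHom (LinearMap.toSpanSingleton A M x)
  have h : g x = g y := by
    rw [← cancel_mono f]
    ext : 1
    refine LinearMap.ext_ring ?_
    change f.hom ((1 : A) • x) = f.hom ((1 : A) • y)
    rw [one_smul, one_smul, hxy]
  have h1 := congrArg (fun k : SemimoduleCat.of A A ⟶ M => k.hom (1 : A)) h
  change (1 : A) • x = (1 : A) • y at h1
  rwa [one_smul, one_smul] at h1

lemma SemimoduleCat.mono_of_injective {A : CommSemiRingCat.{u}} {M M' : SemimoduleCat.{u} A}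
    (f : M ⟶ M') (hf : Function.Injective f.hom) : Mono f :=
  ⟨fun g h e => by
    ext x
    exact hf (congrArg (fun k => k.hom x) e)⟩

variable {A B : CommSemiRingCat.{u}} {R : CommRingCat.{u}} (φ : A ⟶ B)
  (f : A ⟶ (forget₂ CommRingCat CommSemiRingCat).obj R)

/-- The base change `R ⊗_A B` of a semiring `B` to a ring `R`. -/
def ringPushout : CommRingCat.{u} :=
  letI : Algebra A R := f.hom.toAlgebra
  letI : Algebra A B := φ.hom.toAlgebra
  CommRingCat.of (R ⊗[A] B)

/-- The structure map `R ⟶ R ⊗_A B`. -/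
def ringPushoutInl : R ⟶ ringPushout φ f :=
  letI : Algebra A R := f.hom.toAlgebra
  letI : Algebra A B := φ.hom.toAlgebra
  CommRingCat.ofHom (algebraMap R (R ⊗[A] B))

/-- The map `B ⟶ R ⊗_A B`. -/
def ringPushoutInr : B ⟶ (forget₂ CommRingCat CommSemiRingCat).obj (ringPushout φ f) :=
  letI : Algebra A R := f.hom.toAlgebra
  letI : Algebra A B := φ.hom.toAlgebra
  CommSemiRingCat.ofHom (Algebra.TensorProduct.includeRight : B →ₐ[A] R ⊗[A] B).toRingHom

lemma ringPushout_condition : f ≫ (forget₂ CommRingCat CommSemiRingCat).map (ringPushoutInl φ f) =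
    φ ≫ ringPushoutInr φ f := by
  let : Algebra A R := f.hom.toAlgebra
  let : Algebra A B := φ.hom.toAlgebra
  ext a
  exact (Algebra.TensorProduct.includeRight (R := A) (A := R) (B := B)).commutes a |>.symm

variable {φ f} in
lemma ringPushout_hom_ext {T : CommRingCat.{u}} {g h : ringPushout φ f ⟶ T}
    (hl : ringPushoutInl φ f ≫ g = ringPushoutInl φ f ≫ h)
    (hr : ringPushoutInr φ f ≫ (forget₂ CommRingCat CommSemiRingCat).map g =
      ringPushoutInr φ f ≫ (forget₂ CommRingCat CommSemiRingCat).map h) : g = h := by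
  let : Algebra A R := f.hom.toAlgebra
  let : Algebra A B := φ.hom.toAlgebra
  ext x
  have key : ∀ x : R ⊗[A] B, g.hom x = h.hom x := by
    intro x
    induction x using TensorProduct.induction_on with
    | zero => exact (map_zero g.hom).trans (map_zero h.hom).symm
    | add x y hx hy => exact (map_add g.hom x y).trans ((congrArg₂ _ hx hy).trans
        (map_add h.hom x y).symm)
    | tmul r b =>
      have e : (r ⊗ₜ[A] b : R ⊗[A] B) = (r ⊗ₜ 1) * (1 ⊗ₜ b) := by simp
      rw [e]
      refine (map_mul g.hom _ _).trans (Eq.trans ?_ (map_mul h.hom _ _).symm)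
      exact congrArg₂ _ (congrArg (fun k => k.hom r) hl) (congrArg (fun k => k.hom b) hr)
  exact key x

variable {φ f} in
lemma exists_ringPushout_desc {T : CommRingCat.{u}} (g : R ⟶ T)
    (k : B ⟶ (forget₂ CommRingCat CommSemiRingCat).obj T)
    (w : f ≫ (forget₂ CommRingCat CommSemiRingCat).map g = φ ≫ k) :
    ∃ h : ringPushout φ f ⟶ T, ringPushoutInl φ f ≫ h = g ∧
      ringPushoutInr φ f ≫ (forget₂ CommRingCat CommSemiRingCat).map h = k := by
  let : Algebra A R := f.hom.toAlgebra
  let : Algebra A B := φ.hom.toAlgebra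
  let : Algebra R T := g.hom.toAlgebra
  let : Algebra A T := (g.hom.comp f.hom).toAlgebra
  have : IsScalarTower A R T := IsScalarTower.of_algebraMap_eq fun _ => rfl
  let k' : B →ₐ[A] T := { k.hom with commutes' := fun a => (congrArg (fun k => k.hom a) w).symm }
  let h : R ⊗[A] B →ₐ[R] T := Algebra.TensorProduct.lift (Algebra.ofId R T) k'
    (fun _ _ => Commute.all _ _)
  refine ⟨CommRingCat.ofHom h.toRingHom, ?_, ?_⟩
  · ext r
    exact h.commutes r
  · ext b
    change h (1 ⊗ₜ b) = k' b
    simp [h]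

lemma epi_ringPushoutInl [Epi φ] : Epi (ringPushoutInl φ f) :=
  ⟨fun g h e => ringPushout_hom_ext e (by
    rw [← cancel_epi φ, ← Category.assoc, ← Category.assoc, ← ringPushout_condition,
      Category.assoc, Category.assoc, ← Functor.map_comp, ← Functor.map_comp, e])⟩

/-- From `(R ⊗_A B) ⊗_R M ≃ B ⊗_A M`: extending an `R`-module to `R ⊗_A B` amounts to extending the
underlying `A`-semimodule to `B`. Flatness and conservativity transfer through this. -/
lemma exists_equiv_ringPushout {M M' : ModuleCat.{u} R} (v : M ⟶ M') :
    ∃ (w : (semiRestrict f).obj ((SemimoduleCat.of R M : SemimoduleCat.{u}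
          ((forget₂ CommRingCat CommSemiRingCat).obj R))) ⟶
        (semiRestrict f).obj ((SemimoduleCat.of R M' : SemimoduleCat.{u}
          ((forget₂ CommRingCat CommSemiRingCat).obj R))))
      (e : (ModuleCat.extendScalars (ringPushoutInl φ f).hom).obj M ≃ ((semiExtend φ).obj _))
      (e' : (ModuleCat.extendScalars (ringPushoutInl φ f).hom).obj M' ≃ ((semiExtend φ).obj _)),
      ⇑w.hom = v.hom ∧
      e' ∘ ((ModuleCat.extendScalars (ringPushoutInl φ f).hom).map v).hom =
        ((semiExtend φ).map w).hom ∘ e := by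
  let : Algebra A R := f.hom.toAlgebra
  let : Algebra A B := φ.hom.toAlgebra
  let : Module A M := Module.compHom M f.hom
  let : Module A M' := Module.compHom M' f.hom
  have : IsScalarTower A R M := ⟨fun a r x => by
    rw [Algebra.smul_def, mul_smul]; rfl⟩
  have : IsScalarTower A R M' := ⟨fun a r x => by
    rw [Algebra.smul_def, mul_smul]; rfl⟩
  have key : ∀ i : Algebra R (R ⊗[A] B), i = Algebra.TensorProduct.leftAlgebra →
      ∃ (e : @TensorProduct R _ (R ⊗[A] B) M _ _ i.toModule _ ≃ B ⊗[A] M)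
        (e' : @TensorProduct R _ (R ⊗[A] B) M' _ _ i.toModule _ ≃ B ⊗[A] M'),
        e' ∘ @LinearMap.lTensor R _ (R ⊗[A] B) M M' _ _ _ i.toModule _ _ v.hom =
          (v.hom.restrictScalars A).lTensor B ∘ e := by
    rintro _ rfl
    exact exists_equiv_lTensor_baseChange A R B M M' v.hom
  obtain ⟨e, e', h⟩ := key (ringPushoutInl φ f).hom.toAlgebra (Algebra.algebra_ext _ _ fun _ => rfl)
  exact ⟨SemimoduleCat.ofHom (v.hom.restrictScalars A), e, e', rfl, h⟩

lemma flat_ringPushoutInl [PreservesFiniteLimits (semiExtend φ)] :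
    (ringPushoutInl φ f).hom.Flat := by
  let := (ringPushoutInl φ f).hom.toAlgebra
  change Module.Flat R (ringPushout φ f)
  rw [Module.Flat.iff_lTensor_preserves_injective_linearMap'.{u}]
  intro M M' _ _ _ _ g hg
  obtain ⟨w, e, e', hw, h⟩ := exists_equiv_ringPushout φ f (ModuleCat.ofHom g)
  have : Mono w := SemimoduleCat.mono_of_injective _ (by rw [hw]; exact hg)
  have h1 := SemimoduleCat.injective_of_mono ((semiExtend φ).map w)
  have h2 := h1.comp e.injective
  rw [← h] at h2
  exact h2.of_comp

lemma isIso_of_ringPushout {ι : Type*} {B : ι → CommSemiRingCat.{u}} (φ : ∀ i, A ⟶ B i)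
    (hcons : ∀ ⦃M M' : SemimoduleCat.{u} A⦄ (v : M ⟶ M'),
      (∀ i, IsIso ((semiExtend (φ i)).map v)) → IsIso v)
    {M M' : ModuleCat.{u} R} (v : M ⟶ M')
    (hv : ∀ i, IsIso ((ModuleCat.extendScalars.{u, u, u} (ringPushoutInl (φ i) f).hom).map v)) :
    IsIso v := by
  rw [ConcreteCategory.isIso_iff_bijective]
  -- The identity of `A` is used only to obtain `w`, the map `v` regarded as a map of
  -- `A`-semimodules.
  obtain ⟨w, -, -, hw, -⟩ := exists_equiv_ringPushout (𝟙 A) f v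
  have hiso : IsIso w := hcons w fun i => by
    obtain ⟨w', e, e', hw', h⟩ := exists_equiv_ringPushout (φ i) f v
    obtain rfl : w = w' := by
      ext x
      rw [hw, hw']
    have h1 := hv i
    rw [ConcreteCategory.isIso_iff_bijective] at h1 ⊢
    have h2 : Function.Bijective (((semiExtend (φ i)).map w).hom ∘ e) := by
      rw [← h]
      exact e'.bijective.comp h1
    exact (Function.Bijective.of_comp_iff _ e.bijective).1 h2
  rw [ConcreteCategory.isIso_iff_bijective] at hiso
  change Function.Bijective w.hom at hiso
  rw [hw] at hiso
  exact hiso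

end SemiringBaseChange

/-! ### Finite presentation and Zariski opens under base change to a ring. -/

section FinitePresentation

lemma hasColimitsOfShape_commSemiRingCat (J : Type u) [SmallCategory J] [IsFiltered J] :
    HasColimitsOfShape J CommSemiRingCat.{u} :=
  ⟨fun F => ⟨⟨_, CommSemiRingCat.FilteredColimits.colimitCoconeIsColimit.{u, u} F⟩⟩⟩

/-- Filtered colimits of rings and of semirings are both computed on underlying sets. -/
lemma preservesColimitsOfShape_forget₂_commSemiRingCat (J : Type u) [SmallCategory J]
    [IsFiltered J] :
    PreservesColimitsOfShape J (forget₂ CommRingCat.{u} CommSemiRingCat.{u}) := by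
  have := hasColimitsOfShape_commSemiRingCat J
  have : PreservesColimitsOfShape J (forget CommSemiRingCat.{u}) :=
    PreservesFilteredColimitsOfSize.preserves_filtered_colimits J
  have : ReflectsColimitsOfShape J (forget CommSemiRingCat.{u}) :=
    reflectsColimitsOfShape_of_reflectsIsomorphisms
  have : PreservesColimitsOfShape J
      (forget₂ CommRingCat.{u} CommSemiRingCat.{u} ⋙ forget CommSemiRingCat.{u}) :=
    inferInstanceAs (PreservesColimitsOfShape J (forget CommRingCat.{u}))
  exact preservesColimitsOfShape_of_reflects_of_preserves _ (forget CommSemiRingCat.{u})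

variable {A B : CommSemiRingCat.{u}} {R : CommRingCat.{u}} (φ : A ⟶ B)
  (f : A ⟶ (forget₂ CommRingCat CommSemiRingCat).obj R)

/-- The functor viewing an `R`-algebra as a semiring under `A`. -/
abbrev underRestrict : Under R ⥤ Under A :=
  Under.post (forget₂ CommRingCat CommSemiRingCat) ⋙ Under.map f

lemma preservesColimitsOfShape_underRestrict (J : Type u) [SmallCategory J] [IsFiltered J] :
    PreservesColimitsOfShape J (underRestrict f) := by
  have := preservesColimitsOfShape_forget₂_commSemiRingCat J
  -- Connected colimits in `Under A` are computed in the ambient category.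
  have : IsConnected J := IsFiltered.isConnected J
  have : PreservesColimitsOfShape J (underRestrict f ⋙ Under.forget A) :=
    inferInstanceAs (PreservesColimitsOfShape J
      (Under.forget R ⋙ forget₂ CommRingCat CommSemiRingCat))
  have : ReflectsColimitsOfShape J (Under.forget A) := inferInstance
  exact preservesColimitsOfShape_of_reflects_of_preserves _ (Under.forget A)

/-- Under the adjunction between base change and restriction, algebra maps out of `R ⊗_A B` are
algebra maps out of `B`. -/
def underRingPushoutIso : underRestrict f ⋙ coyoneda.obj (op (Under.mk φ)) ≅
    coyoneda.obj (op (Under.mk (ringPushoutInl φ f))) :=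
  (NatIso.ofComponents (fun T => Equiv.toIso (Equiv.ofBijective
    (fun h : Under.mk (ringPushoutInl φ f) ⟶ T =>
      (Under.homMk (U := Under.mk φ) (V := (underRestrict f).obj T) (ringPushoutInr φ f ≫
        (forget₂ CommRingCat CommSemiRingCat).map h.right) (by
          have h1 := Under.w h
          change φ ≫ ringPushoutInr φ f ≫ _ = f ≫ (forget₂ CommRingCat CommSemiRingCat).map T.hom
          rw [← Category.assoc, ← ringPushout_condition, Category.assoc, ← Functor.map_comp]
          exact congrArg (fun k => f ≫ (forget₂ CommRingCat CommSemiRingCat).map k) h1)))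
    (by
      constructor
      · intro g h e
        refine Under.UnderMorphism.ext ?_
        refine ringPushout_hom_ext ((Under.w g).trans (Under.w h).symm) ?_
        exact congrArg (fun k => k.right) e
      · intro k
        obtain ⟨h, hl, hr⟩ := exists_ringPushout_desc (φ := φ) (f := f) T.hom k.right
          (Under.w k).symm
        refine ⟨Under.homMk h hl, ?_⟩
        refine Under.UnderMorphism.ext ?_
        exact hr))) (fun g => by
          ext h
          rfl)).symm

/-- Maps out of `R ⊗_A B` are maps out of `B` into the restricted algebra, and restriction commutes
with filtered colimits. -/
lemma isFinitelyPresentable_ringPushoutInl [IsFinitelyPresentable.{u} (Under.mk φ)] :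
    IsFinitelyPresentable.{u} (Under.mk (ringPushoutInl φ f)) := by
  rw [isFinitelyPresentable_iff_preservesFilteredColimitsOfSize]
  refine ⟨fun J _ _ => ?_⟩
  have := preservesColimitsOfShape_underRestrict f J
  have : PreservesColimitsOfShape J (coyoneda.obj (op (Under.mk φ))) :=
    PreservesFilteredColimitsOfSize.preserves_filtered_colimits J
  exact preservesColimitsOfShape_of_natIso (underRingPushoutIso φ f)

/-- Zariski opens over `ℕ` become Zariski opens after base change to a ring. -/
lemma isZariskiOpen_ringPushoutInl (h : overN.{u}.IsZariskiOpen φ) :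
    overZ.{u}.IsZariskiOpen (ringPushoutInl φ f) := by
  obtain ⟨h1, h2, h3⟩ := h
  have : PreservesFiniteLimits (semiExtend φ) := h1
  exact isZariskiOpen_overZ_of_flat _ (flat_ringPushoutInl φ f) (epi_ringPushoutInl φ f)
    (isFinitelyPresentable_ringPushoutInl φ f)

end FinitePresentation

/-! ### Lifting coverings of semirings to coverings by rings. -/

section Cocontinuous

/-- The pullback of an `ℕ`-covering sieve to a ring contains a Zariski covering by rings. -/
lemma functorPullback_pullback_mem {A : CommSemiRingCat.{u}} {R : CommRingCat.{u}}
    (S : Sieve (op A)) (hS : S ∈ overN.{u}.zariskiTopology (op A))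
    (f : A ⟶ (forget₂ CommRingCat CommSemiRingCat).obj R) :
    (S.pullback f.op).functorPullback (forget₂ CommRingCat CommSemiRingCat).op (X := op R) ∈
      overZ.{u}.zariskiTopology (op R) := by
  -- Induction on how the covering sieve is generated. Quantifying over all rings mapping to the
  -- base makes the hypothesis stable under pullback, as the last two cases require.
  suffices h : ∀ (X : CommSemiRingCat.{u}ᵒᵖ) (S : Sieve X),
      overN.{u}.zariskiPrecoverage.Saturate X S → ∀ (R : CommRingCat.{u}ᵒᵖ)
        (f : (forget₂ CommRingCat CommSemiRingCat).op.obj R ⟶ X),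
        (S.pullback f).functorPullback (forget₂ CommRingCat CommSemiRingCat).op ∈
          overZ.{u}.zariskiTopology R from h _ _ hS _ f.op
  intro X S hS
  induction hS with
  | of X P hP =>
    intro R f
    obtain ⟨hopen, n, B, φ, hφ, hcons⟩ := hP
    refine GrothendieckTopology.superset_covering _ ?_
      (Precoverage.generate_mem_toGrothendieck
        (R := Presieve.ofArrows (fun i => op (ringPushout (φ i) f.unop))
          (fun i => (ringPushoutInl (φ i) f.unop).op)) ⟨?_, n, _, _, fun i => ⟨i⟩, ?_⟩)
    · rw [Sieve.generate_le_iff]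
      rintro _ _ ⟨i⟩
      refine ⟨_, (ringPushoutInr (φ i) f.unop).op, _, hφ i, ?_⟩
      exact congrArg Quiver.Hom.op (ringPushout_condition (φ i) f.unop).symm
    · rintro _ _ ⟨i⟩
      exact isZariskiOpen_ringPushoutInl _ _ (hopen _ (hφ i))
    · intro M M' v hv
      exact isIso_of_ringPushout f.unop φ hcons v hv
  | top X =>
    intro R f
    exact GrothendieckTopology.superset_covering _ (fun _ _ _ => trivial)
      (GrothendieckTopology.top_mem _ _)
  | pullback X S _ Y g ih =>
    intro R f
    rw [← Sieve.pullback_comp]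
    exact ih R _
  | transitive X S T _ _ ihS ihT =>
    intro R f
    refine GrothendieckTopology.transitive _ (ihS R f) _ fun R' g hg => ?_
    have h := ihT hg R' (𝟙 _)
    refine GrothendieckTopology.superset_covering _ ?_ h
    intro R'' k hk
    change T _ at hk
    change T _
    simpa using hk

instance isCocontinuous_forget₂_op :
    (forget₂ CommRingCat.{u} CommSemiRingCat.{u}).op.IsCocontinuous
      overZ.{u}.zariskiTopology overN.{u}.zariskiTopology where
  cover_lift {R S} hS := by
    have h := functorPullback_pullback_mem S hS (𝟙 _)
    rwa [op_id, Sieve.pullback_id] at h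

end Cocontinuous

/-! ### Open immersions of schemes and their functors of points. -/

section SchemeCharts

open AlgebraicGeometry

variable {X : Scheme.{u}} {A D : CommRingCat.{u}}

/-- The morphism of functors of points induced by `Spec A ⟶ X`. -/
def repToFunctorOfPoints (j : Spec A ⟶ X) : rep A ⟶ functorOfPoints X where
  app T := TypeCat.ofHom fun g => ⟨Spec.map g.down.unop ≫ j⟩
  naturality T T' g := by
    ext x
    refine congrArg ULift.up ?_
    change Spec.map (x.down.unop ≫ g.unop.unop) ≫ j =
      Spec.map g.unop.unop ≫ Spec.map x.down.unop ≫ j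
    rw [Spec.map_comp, Category.assoc]

lemma mem_range_repToFunctorOfPoints (j : Spec A ⟶ X) (y : (functorOfPoints X).obj (op (op D))) :
    y ∈ Set.range ((repToFunctorOfPoints j).app (op (op D))) ↔ ∃ k : Spec D ⟶ Spec A,
      k ≫ j = y.down := by
  constructor
  · rintro ⟨g, rfl⟩
    exact ⟨Spec.map g.down.unop, rfl⟩
  · rintro ⟨k, hk⟩
    refine ⟨⟨(Spec.preimage k).op⟩, ULift.down_injective ?_⟩
    change Spec.map (Spec.preimage k) ≫ j = _
    rw [Spec.map_preimage, hk]

lemma functorOfPoints_map (a : A ⟶ D) (y : (functorOfPoints X).obj (op (op A))) :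
    ((functorOfPoints X).map a.op.op y).down = Spec.map a ≫ y.down := rfl

/-- Factoring through a monomorphism of schemes can be checked Zariski locally. -/
lemma exists_factor_of_locally {Y : Scheme.{u}} (j : Y ⟶ X) [Mono j] (x : Spec D ⟶ X)
    (S : Sieve (op D)) (hS : S ∈ overZ.{u}.zariskiTopology (op D))
    (h : ∀ ⦃D' : CommRingCat.{u}⦄ (d : D ⟶ D'), S d.op → ∃ k : Spec D' ⟶ Y, k ≫ j = Spec.map d ≫ x) :
    ∃ k : Spec D ⟶ Y, k ≫ j = x := by
  have hY := (isSheaf_iff_isSheaf_of_type _ _).1 (isSheaf_functorOfPoints Y)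
  have hX := (isSheaf_iff_isSheaf_of_type _ _).1 (isSheaf_functorOfPoints X)
  choose k hk using h
  let fam : Presieve.FamilyOfElements (functorOfPoints Y) S.arrows := fun E g hg =>
    ⟨k (D' := E.unop) g.unop hg⟩
  -- Since `j` is a monomorphism, the local factorizations are unique, hence compatible; they glue
  -- because the functor of points of `Y` is a sheaf.
  have hfam : fam.Compatible := by
    rw [Presieve.compatible_iff_sieveCompatible]
    intro E E' g g' hg
    refine ULift.down_injective ((cancel_mono j).1 ?_)
    refine (hk _ _).trans ?_
    change Spec.map (g.unop ≫ g'.unop) ≫ x = (Spec.map g'.unop ≫ k g.unop hg) ≫ j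
    rw [Category.assoc, hk, Spec.map_comp, Category.assoc]
  obtain ⟨y, hy, -⟩ := hY S hS fam hfam
  refine ⟨y.down, ?_⟩
  refine congrArg ULift.down ((hX S hS).isSeparatedFor.ext
    (t₁ := (⟨y.down ≫ j⟩ : (functorOfPoints X).obj (op (op D)))) (t₂ := ⟨x⟩) fun E g hg => ?_)
  refine ULift.down_injective ?_
  change Spec.map g.unop ≫ y.down ≫ j = Spec.map g.unop ≫ x
  rw [← hk g.unop hg, ← Category.assoc]
  exact congrArg (fun z => ULift.down z ≫ j) (hy g hg)

/-- The primes in the image of a localization `Spec R[1/r] → Spec R`. -/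
lemma range_specMap_awayMap (r : A) :
    Set.range (Spec.map (awayMap A r)) = (PrimeSpectrum.basicOpen r : Set (PrimeSpectrum A)) :=
  PrimeSpectrum.localization_away_comap_range (Localization.Away r) r

lemma exists_basicOpen_le (j : Spec A ⟶ X) [IsOpenImmersion j] (x : Spec D ⟶ X) (p : Spec D)
    (hp : x p ∈ Set.range j) :
    ∃ r : D, p ∈ PrimeSpectrum.basicOpen r ∧
      ∃ k : Spec (CommRingCat.of (Localization.Away r)) ⟶ Spec A,
        k ≫ j = Spec.map (awayMap D r) ≫ x := by
  have hU : IsOpen (x ⁻¹' Set.range j) := j.isOpenEmbedding.isOpen_range.preimage x.continuous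
  obtain ⟨_, ⟨r, rfl⟩, hpr, hr⟩ :=
    PrimeSpectrum.isTopologicalBasis_basic_opens.exists_subset_of_mem_open hp hU
  refine ⟨r, hpr, IsOpenImmersion.lift j (Spec.map (awayMap D r) ≫ x) ?_,
    IsOpenImmersion.lift_fac _ _ _⟩
  rw [Scheme.Hom.comp_base, TopCat.coe_comp, Set.range_comp, range_specMap_awayMap]
  exact Set.image_subset_iff.2 hr

lemma span_eq_top_of_forall_exists {s : Set D}
    (h : ∀ p : PrimeSpectrum D, ∃ r ∈ s, p ∈ PrimeSpectrum.basicOpen r) : Ideal.span s = ⊤ := by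
  by_contra hs
  obtain ⟨m, hm, hle⟩ := Ideal.exists_le_maximal _ hs
  obtain ⟨r, hr, hp⟩ := h ⟨m, hm.isPrime⟩
  exact hp (hle (Ideal.subset_span hr))

lemma exists_awayMap_lift (a : A ⟶ D) (r : A) :
    ∃ b, awayMap A r ≫ b = a ≫ awayMap D (a r) := by
  have hu : IsUnit (((algebraMap D (Localization.Away (a r))).comp a.hom) r) :=
    IsLocalization.Away.algebraMap_isUnit (S := Localization.Away (a r)) (a r)
  refine ⟨CommRingCat.ofHom (IsLocalization.Away.lift r hu), ?_⟩
  ext1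
  exact IsLocalization.Away.lift_comp r hu

/-- The inverse image of the open subscheme in `Spec B` is the union of the basic opens over which
`x` factors through `j`; all of them together are the required family of Zariski opens. -/
lemma isOpenImmersion_repToFunctorOfPoints (j : Spec A ⟶ X) [IsOpenImmersion j] :
    overZ.{u}.IsOpenImmersion (repToFunctorOfPoints j) where
  injective T := by
    rintro ⟨g⟩ ⟨h⟩ e
    have e1 := (cancel_mono j).1 (congrArg ULift.down e)
    exact congrArg (fun k => ULift.up (Quiver.Hom.op k)) (Spec.map_injective e1)
  image B x := by
    refine ⟨{r : B // ∃ k : Spec (CommRingCat.of (Localization.Away r)) ⟶ Spec A,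
        k ≫ j = Spec.map (awayMap B r) ≫ x.down}, _, fun r => awayMap B r.1,
      fun r => isZariskiOpen_awayMap _, fun D a => ?_⟩
    rw [mem_range_repToFunctorOfPoints, functorOfPoints_map]
    constructor
    · rintro ⟨k, hk⟩
      let T : Set D := {s | ∃ r : B, (∃ k : Spec (CommRingCat.of (Localization.Away r)) ⟶ Spec A,
        k ≫ j = Spec.map (awayMap B r) ≫ x.down) ∧ a r = s}
      let S : Sieve (op D) :=
        { arrows := fun E g => ∃ (r : {r : B // ∃ k : Spec (CommRingCat.of (Localization.Away r)) ⟶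
            Spec A, k ≫ j = Spec.map (awayMap B r) ≫ x.down})
            (b : CommRingCat.of (Localization.Away r.1) ⟶ E.unop),
            awayMap B r.1 ≫ b = a ≫ g.unop
          downward_closed := by
            rintro E E' g ⟨r, b, hb⟩ g'
            refine ⟨r, b ≫ g'.unop, ?_⟩
            rw [← Category.assoc, hb, Category.assoc]
            rfl }
      refine ⟨S, mem_zariskiTopology_of_span_eq_top (s := T) ?_ S ?_, fun D' d hd => hd⟩
      -- When the point of `Spec D` factors through `j`, the basic opens of `Spec B` found above
      -- pull back to a covering of `Spec D`.
      · refine span_eq_top_of_forall_exists fun p => ?_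
        obtain ⟨r, hr, hk'⟩ := exists_basicOpen_le j x.down (Spec.map a p)
          ⟨k p, congrArg (fun f : Spec D ⟶ X => f p) hk⟩
        exact ⟨a r, ⟨r, hk', rfl⟩, hr⟩
      · rintro _ ⟨r, hr, rfl⟩
        exact ⟨⟨r, hr⟩, exists_awayMap_lift a r⟩
    · rintro ⟨S, hS, h⟩
      refine exists_factor_of_locally j _ S hS fun D' d hd => ?_
      obtain ⟨⟨r, k, hk⟩, b, hb⟩ := h d hd
      refine ⟨Spec.map b ≫ k, ?_⟩
      rw [Category.assoc, hk, ← Category.assoc, ← Category.assoc, ← Spec.map_comp,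
        ← Spec.map_comp, hb]

/-- Points of a scheme lie, locally, in the members of an affine open cover. -/
lemma exists_sieve_factor {ι : Type*} {A : ι → CommRingCat.{u}} (j : ∀ i, Spec (A i) ⟶ X)
    [∀ i, IsOpenImmersion (j i)] (hj : ∀ x : X, ∃ i, x ∈ Set.range (j i)) (x : Spec D ⟶ X) :
    ∃ S ∈ overZ.{u}.zariskiTopology (op D), ∀ ⦃D' : CommRingCat.{u}⦄ (d : D ⟶ D'), S d.op →
      ∃ i, ∃ k : Spec D' ⟶ Spec (A i), k ≫ j i = Spec.map d ≫ x := by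
  let S : Sieve (op D) :=
    { arrows := fun E g => ∃ i, ∃ k : Spec E.unop ⟶ Spec (A i), k ≫ j i = Spec.map g.unop ≫ x
      downward_closed := by
        rintro E E' g ⟨i, k, hk⟩ g'
        refine ⟨i, Spec.map g'.unop ≫ k, ?_⟩
        rw [Category.assoc, hk, ← Category.assoc, ← Spec.map_comp]
        rfl }
  refine ⟨S, mem_zariskiTopology_of_span_eq_top
    (s := {r | S (awayMap D r).op}) (span_eq_top_of_forall_exists fun p => ?_) S fun r hr => hr,
    fun D' d hd => hd⟩
  obtain ⟨i, hi⟩ := hj (x p)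
  obtain ⟨r, hr, hk⟩ := exists_basicOpen_le (j i) x p hi
  exact ⟨r, ⟨i, hk⟩, hr⟩

/-- An affine open cover of a scheme gives an affine Zariski covering of its functor of points. -/
lemma isAffineCovering_functorOfPoints {ι : Type u} {A : ι → CommRingCat.{u}}
    (j : ∀ i, Spec (A i) ⟶ X) [∀ i, IsOpenImmersion (j i)]
    (hj : ∀ x : X, ∃ i, x ∈ Set.range (j i)) :
    overZ.{u}.IsAffineCovering fun i => repToFunctorOfPoints (j i) where
  isOpenImmersion i := isOpenImmersion_repToFunctorOfPoints (j i)
  epi D y := by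
    obtain ⟨S, hS, h⟩ := exists_sieve_factor j hj y.down
    refine ⟨S, hS, fun D' d hd => ?_⟩
    obtain ⟨i, hi⟩ := h d hd
    exact ⟨i, (mem_range_repToFunctorOfPoints _ _).2 hi⟩

end SchemeCharts

/-! ### Invariance of affine coverings under isomorphism of the target. -/

section Transport

variable {C : Type (u + 1)} [LargeCategory.{u} C] {T : ModuleTheory C}

lemma ModuleTheory.IsOpenImmersion.comp_iso {F G G' : AffPresheaf C} {f : F ⟶ G}
    (h : T.IsOpenImmersion f) (e : G ≅ G') : T.IsOpenImmersion (f ≫ e.hom) where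
  injective X := by
    have : Function.Injective (e.hom.app X) := ((e.app X).toEquiv).injective
    exact this.comp (h.injective X)
  image A x := by
    obtain ⟨ι, B, φ, hφ, H⟩ := h.image A (e.inv.app _ x)
    refine ⟨ι, B, φ, hφ, fun D a => ?_⟩
    rw [← H D a]
    have hinj : Function.Injective (e.hom.app (op (op D))) := ((e.app _).toEquiv).injective
    have hx : G'.map a.op.op x = e.hom.app _ (G.map a.op.op (e.inv.app _ x)) := by
      rw [← NatTrans.naturality_apply]
      simp
    rw [hx]
    change _ ∈ Set.range (e.hom.app (op (op D)) ∘ f.app (op (op D))) ↔ _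
    rw [Set.range_comp]
    exact hinj.mem_set_image

lemma ModuleTheory.IsAffineCovering.comp_iso {F G : AffPresheaf C} {ι : Type u} {A : ι → C}
    {p : ∀ i, rep (A i) ⟶ F} (h : T.IsAffineCovering p) (e : F ≅ G) :
    T.IsAffineCovering fun i => p i ≫ e.hom where
  isOpenImmersion i := (h.isOpenImmersion i).comp_iso e
  epi D y := by
    obtain ⟨S, hS, H⟩ := h.epi D (e.inv.app _ y)
    refine ⟨S, hS, fun D' d hd => ?_⟩
    obtain ⟨i, z, hz⟩ := H d hd
    refine ⟨i, z, ?_⟩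
    change e.hom.app _ ((p i).app _ z) = _
    rw [hz, ← NatTrans.naturality_apply]
    simp

end Transport

/-! ### The adjunction between monoid rings and multiplicative monoids of rings. -/

section MonoidRing

variable {M M' : CommMonCat.{u}} {R R' : CommRingCat.{u}}

/-- The multiplicative monoid of a ring. -/
abbrev ringMonoid : CommRingCat.{u} ⥤ CommMonCat.{u} :=
  forget₂ CommRingCat.{u} CommSemiRingCat.{u} ⋙ forget₂ CommSemiRingCat.{u} CommMonCat.{u}

/-- The ring homomorphism `ℤ[M] ⟶ R` given by a monoid homomorphism `M ⟶ R`. -/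
def monoidRingLift (f : M ⟶ ringMonoid.obj R) : intMonoidRing.obj M ⟶ R :=
  CommRingCat.ofHom (MonoidAlgebra.lift ℤ R M (f.hom : M →* R)).toRingHom

lemma monoidRingLift_single (f : M ⟶ ringMonoid.obj R) (m : M) :
    (monoidRingLift f).hom (MonoidAlgebra.of ℤ M m) = f.hom m :=
  MonoidAlgebra.lift_of (R := ℤ) (A := R) (f.hom : M →* R) m

lemma monoidRing_hom_ext {g h : intMonoidRing.obj M ⟶ R}
    (e : ∀ m : M, g.hom (MonoidAlgebra.of ℤ M m) = h.hom (MonoidAlgebra.of ℤ M m)) : g = h := by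
  ext1
  exact MonoidAlgebra.ringHom_ext (fun r => RingHom.congr_fun
    (RingHom.ext_int (g.hom.comp MonoidAlgebra.singleOneRingHom)
      (h.hom.comp MonoidAlgebra.singleOneRingHom)) r) e

lemma monoidRingLift_injective {f g : M ⟶ ringMonoid.obj R}
    (e : monoidRingLift f = monoidRingLift g) : f = g := by
  ext m
  have h := congrArg (fun k => k.hom (MonoidAlgebra.of ℤ M m)) e
  exact (monoidRingLift_single f m).symm.trans (h.trans (monoidRingLift_single g m))

lemma monoidRingLift_surjective (g : intMonoidRing.obj M ⟶ R) :
    ∃ f : M ⟶ ringMonoid.obj R, monoidRingLift f = g := by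
  refine ⟨CommMonCat.ofHom ((RingHom.toMonoidHom (α := MonoidAlgebra ℤ M) (β := R) g.hom).comp
    (MonoidAlgebra.of ℤ M)), ?_⟩
  exact monoidRing_hom_ext fun m => monoidRingLift_single _ m

lemma monoidRingLift_comp (f : M ⟶ ringMonoid.obj R) (g : R ⟶ R') :
    monoidRingLift (f ≫ ringMonoid.map g) = monoidRingLift f ≫ g :=
  monoidRing_hom_ext fun m =>
    (monoidRingLift_single _ m).trans (congrArg g.hom (monoidRingLift_single f m)).symm

lemma map_monoidRingLift (k : M' ⟶ M) (f : M ⟶ ringMonoid.obj R) :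
    intMonoidRing.map k ≫ monoidRingLift f = monoidRingLift (k ≫ f) := by
  refine monoidRing_hom_ext fun m => ?_
  refine Eq.trans ?_ (monoidRingLift_single _ m).symm
  refine Eq.trans ?_ (monoidRingLift_single f (k.hom m))
  refine congrArg (monoidRingLift f).hom ?_
  exact MonoidAlgebra.mapDomain_single

end MonoidRing

/-! ### The toric functor over `𝔽₁` evaluated on rings. -/

section ToricF1OnRings

variable {N : Type u} [AddCommGroup N] {Δ : Fan N} {R R' : CommRingCat.{u}}

variable (Δ) in
/-- The functor `R ↦ X_{𝔽₁}(Δ)(R, ·)`. -/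
def toricF1OnRings : AffPresheaf CommRingCat.{u} := ringMonoid.op.op ⋙ (toricF1 Δ).obj

/-- The point of `R ↦ X_{𝔽₁}(Δ)(R, ·)` with coordinates `f` in the chart of `σ`. -/
def toricF1OnRingsPoint (σ : Δ.cones) (f : coneMonoid σ.1 ⟶ ringMonoid.obj R) :
    (toricF1OnRings Δ).obj (op (op R)) :=
  (toricChart Δ σ).hom.app _ (toricPoint f)

lemma exists_toricF1OnRingsPoint (y : (toricF1OnRings Δ).obj (op (op R))) :
    ∃ (σ : Δ.cones) (f : coneMonoid σ.1 ⟶ ringMonoid.obj R), toricF1OnRingsPoint σ f = y :=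
  exists_toricChart y

lemma toricF1OnRings_map (σ : Δ.cones) (f : coneMonoid σ.1 ⟶ ringMonoid.obj R) (g : R ⟶ R') :
    (toricF1OnRings Δ).map g.op.op (toricF1OnRingsPoint σ f) =
      toricF1OnRingsPoint σ (f ≫ ringMonoid.map g) := by
  rw [toricF1OnRingsPoint, toricF1OnRingsPoint, ← toricPoint_map]
  exact (ConcreteCategory.congr_hom
    ((toricChart Δ σ).hom.naturality (ringMonoid.map g).op.op) _).symm

end ToricF1OnRings

/-! ### Comparison with the functor of points of the toric scheme. -/

section ToricPoints

open AlgebraicGeometry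

variable {N : Type u} [AddCommGroup N] [Module.Free ℤ N] [Module.Finite ℤ N] {Δ : Fan N}
variable {R R' : CommRingCat.{u}}

variable (Δ) in
/-- The chart `Spec ℤ[M_σ] ⟶ X_ℤ(Δ)`. -/
def toricSchemeChart (σ : Δ.cones) : Spec (intMonoidRing.obj (coneMonoid σ.1)) ⟶ toricScheme Δ :=
  colimit.ι (toricDiagram Δ) σ

instance (σ : Δ.cones) : IsOpenImmersion (toricSchemeChart Δ σ) :=
  inferInstanceAs (IsOpenImmersion (colimit.ι (toricDiagram Δ) σ))

lemma toricSchemeChart_w {τ σ : Δ.cones} (h : τ.1 ≤ σ.1) :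
    Spec.map (intMonoidRing.map (coneMonoidMap h)) ≫ toricSchemeChart Δ σ =
      toricSchemeChart Δ τ :=
  colimit.w (toricDiagram Δ) (homOfLE h : τ ⟶ σ)

lemma exists_mem_range_toricSchemeChart (x : toricScheme Δ) :
    ∃ σ, x ∈ Set.range (toricSchemeChart Δ σ) :=
  Scheme.IsLocallyDirected.ι_jointly_surjective (toricDiagram Δ) x

/-- The point of `X_ℤ(Δ)` with coordinates `f` in the chart of `σ`. -/
def toricSchemePoint (σ : Δ.cones) (f : coneMonoid σ.1 ⟶ ringMonoid.obj R) :
    Spec R ⟶ toricScheme Δ :=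
  Spec.map (monoidRingLift f) ≫ toricSchemeChart Δ σ

lemma specMap_toricSchemePoint (σ : Δ.cones) (f : coneMonoid σ.1 ⟶ ringMonoid.obj R)
    (g : R ⟶ R') :
    Spec.map g ≫ toricSchemePoint σ f = toricSchemePoint σ (f ≫ ringMonoid.map g) := by
  rw [toricSchemePoint, toricSchemePoint, monoidRingLift_comp, Spec.map_comp, Category.assoc]

/-- The cone `σ ∩ σ'` of the fan. -/
def Fan.inf (σ σ' : Δ.cones) : Δ.cones :=
  ⟨σ.1 ⊓ σ'.1, Δ.face_mem _ σ.2 _ (Δ.inf_isFace_left _ σ.2 _ σ'.2)⟩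

lemma toricSchemePoint_restrict {τ σ : Δ.cones} (h : τ.1 ≤ σ.1)
    (g : coneMonoid τ.1 ⟶ ringMonoid.obj R) :
    toricSchemePoint σ (coneMonoidMap h ≫ g) = toricSchemePoint τ g := by
  rw [toricSchemePoint, toricSchemePoint, ← map_monoidRingLift, Spec.map_comp, Category.assoc,
    toricSchemeChart_w]

/-- Points with the same image in the charts of `σ` and `σ'` come from a common face. -/
lemma exists_of_toricSchemePoint_eq {τ σ σ' : Δ.cones} (hτ : τ ≤ σ) (hτ' : τ ≤ σ')
    (hinf : ∀ ρ : Δ.cones, ρ ≤ σ → ρ ≤ σ' → ρ ≤ τ) {f : coneMonoid σ.1 ⟶ ringMonoid.obj R}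
    {f' : coneMonoid σ'.1 ⟶ ringMonoid.obj R} (h : toricSchemePoint σ f = toricSchemePoint σ' f') :
    ∃ g : coneMonoid τ.1 ⟶ ringMonoid.obj R,
      coneMonoidMap hτ ≫ g = f ∧ coneMonoidMap hτ' ≫ g = f' := by
  have hi : IsOpenImmersion (Spec.map (intMonoidRing.map (coneMonoidMap hτ))) :=
    toricDiagram_isOpenImmersion Δ (homOfLE hτ)
  -- In the glued scheme, points of two charts coincide only through some cone `ρ` contained in
  -- both; `hinf` places `ρ` inside `τ`, so the image of `Spec R` lies in the open chart of `τ`.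
  have hr : Set.range (Spec.map (monoidRingLift f)) ⊆
      Set.range (Spec.map (intMonoidRing.map (coneMonoidMap hτ))) := by
    rintro _ ⟨p, rfl⟩
    have hp := congrArg (fun k : Spec R ⟶ toricScheme Δ => k p) h
    obtain ⟨ρ, hρ, hρ', z, hz, -⟩ :=
      (Scheme.IsLocallyDirected.ι_eq_ι_iff (toricDiagram Δ)).1 hp
    let l : ρ ⟶ τ := homOfLE (hinf ρ (leOfHom hρ) (leOfHom hρ'))
    refine ⟨(toricDiagram Δ).map l z, Eq.trans ?_ hz⟩
    exact congrArg (fun k : (toricDiagram Δ).obj ρ ⟶ (toricDiagram Δ).obj σ => k z)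
      ((toricDiagram Δ).map_comp l (homOfLE hτ)).symm
  obtain ⟨g, hg⟩ := monoidRingLift_surjective
    (Spec.preimage (IsOpenImmersion.lift _ (Spec.map (monoidRingLift f)) hr))
  have h1 : coneMonoidMap hτ ≫ g = f := by
    refine monoidRingLift_injective (Spec.map_injective ?_)
    rw [← map_monoidRingLift, Spec.map_comp, hg, Spec.map_preimage, IsOpenImmersion.lift_fac]
  refine ⟨g, h1, ?_⟩
  -- The lift was built from `σ` alone; its agreement with `f'` follows because the chart of `σ'` is
  -- a monomorphism.
  have h2 : toricSchemePoint σ' (coneMonoidMap hτ' ≫ g) = toricSchemePoint σ' f' := by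
    rw [← h, ← h1, toricSchemePoint_restrict, toricSchemePoint_restrict]
  exact monoidRingLift_injective (Spec.map_injective ((cancel_mono _).1 h2))

/-- The charts of `σ` and `σ'` meet in the chart of `σ ∩ σ'`. -/
lemma toricSchemePoint_eq_iff {σ σ' : Δ.cones} {f : coneMonoid σ.1 ⟶ ringMonoid.obj R}
    {f' : coneMonoid σ'.1 ⟶ ringMonoid.obj R} :
    toricSchemePoint σ f = toricSchemePoint σ' f' ↔ AgreeOnInf f f' := by
  constructor
  · exact exists_of_toricSchemePoint_eq (τ := Fan.inf σ σ')
      (show σ.1 ⊓ σ'.1 ≤ σ.1 from inf_le_left) (show σ.1 ⊓ σ'.1 ≤ σ'.1 from inf_le_right)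
      fun ρ h h' => show ρ.1 ≤ σ.1 ⊓ σ'.1 from le_inf h h'
  · rintro ⟨g, rfl, rfl⟩
    exact (toricSchemePoint_restrict (τ := Fan.inf σ σ') inf_le_left g).trans
      (toricSchemePoint_restrict (τ := Fan.inf σ σ') inf_le_right g).symm

/-- Well-definedness of the comparison: two coordinate descriptions of `y` are related by
`AgreeOnInf`, and so give the same point of the toric scheme. -/
lemma exists_toricComparison_eq (y : (toricF1OnRings Δ).obj (op (op R))) :
    ∃ x : Spec R ⟶ toricScheme Δ, ∀ (σ : Δ.cones) (f : coneMonoid σ.1 ⟶ ringMonoid.obj R),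
      toricF1OnRingsPoint σ f = y → toricSchemePoint σ f = x := by
  obtain ⟨σ, f, rfl⟩ := exists_toricF1OnRingsPoint y
  exact ⟨toricSchemePoint σ f, fun σ' f' h =>
    toricSchemePoint_eq_iff.2 (toricChart_eq_iff.1 h)⟩

variable (Δ) in
/-- The comparison map from `R ↦ X_{𝔽₁}(Δ)(R, ·)` to the functor of points of `X_ℤ(Δ)`. -/
def toricComparison : toricF1OnRings Δ ⟶ functorOfPoints (toricScheme Δ) where
  app T := TypeCat.ofHom fun y => ⟨(exists_toricComparison_eq (R := T.unop.unop) y).choose⟩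
  naturality T T' g := by
    ext y
    refine congrArg ULift.up ?_
    obtain ⟨σ, f, rfl⟩ := exists_toricF1OnRingsPoint (R := T.unop.unop) y
    have h1 := (exists_toricComparison_eq (toricF1OnRingsPoint σ f)).choose_spec σ f rfl
    have h2 := (exists_toricComparison_eq ((toricF1OnRings Δ).map g
      (toricF1OnRingsPoint σ f))).choose_spec σ _ (toricF1OnRings_map σ f g.unop.unop).symm
    refine h2.symm.trans ?_
    rw [← specMap_toricSchemePoint, h1]
    rfl

lemma toricComparison_toricF1OnRingsPoint (σ : Δ.cones)
    (f : coneMonoid σ.1 ⟶ ringMonoid.obj R) :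
    (toricComparison Δ).app (op (op R)) (toricF1OnRingsPoint σ f) = ⟨toricSchemePoint σ f⟩ :=
  congrArg ULift.up
    ((exists_toricComparison_eq (toricF1OnRingsPoint σ f)).choose_spec σ f rfl).symm

instance isLocallyInjective_toricComparison :
    Presheaf.IsLocallyInjective overZ.{u}.zariskiTopology (toricComparison Δ) :=
  Presheaf.isLocallyInjective_of_injective _ _ fun T y y' h => by
    obtain ⟨σ, f, rfl⟩ := exists_toricF1OnRingsPoint (R := T.unop.unop) y
    obtain ⟨σ', f', rfl⟩ := exists_toricF1OnRingsPoint (R := T.unop.unop) y'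
    have h1 := (toricComparison_toricF1OnRingsPoint σ f).symm.trans
      (h.trans (toricComparison_toricF1OnRingsPoint σ' f'))
    exact toricChart_eq_iff.2 (toricSchemePoint_eq_iff.1 (congrArg ULift.down h1))

/-- A morphism `Spec R ⟶ X_ℤ(Δ)` need not factor through one chart, but it does so locally; this is
what sheafification over `ℤ` repairs. -/
instance isLocallySurjective_toricComparison :
    Presheaf.IsLocallySurjective overZ.{u}.zariskiTopology (toricComparison Δ) where
  imageSieve_mem {D} x := by
    obtain ⟨S, hS, h⟩ := exists_sieve_factor (D := D.unop) (toricSchemeChart Δ)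
      exists_mem_range_toricSchemeChart x.down
    refine GrothendieckTopology.superset_covering _ (fun E g hg => ?_) hS
    obtain ⟨σ, k, hk⟩ := h g.unop hg
    obtain ⟨f, hf⟩ := monoidRingLift_surjective (Spec.preimage k)
    refine ⟨toricF1OnRingsPoint σ f, (toricComparison_toricF1OnRingsPoint σ f).trans ?_⟩
    refine congrArg ULift.up ?_
    rw [toricSchemePoint, hf, Spec.map_preimage, hk]
    rfl

variable (Δ) in
lemma isAffineCovering_toricSchemeChart :
    overZ.{u}.IsAffineCovering fun σ : Δ.cones => repToFunctorOfPoints (toricSchemeChart Δ σ) :=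
  isAffineCovering_functorOfPoints _ exists_mem_range_toricSchemeChart

end ToricPoints

/-! ### The base change to `ℤ` as a sheaf and as a scheme. -/

section BaseChange

variable {J : GrothendieckTopology CommRingCat.{u}ᵒᵖ}

lemma isIso_presheafToSheaf_map {P Q : AffPresheaf CommRingCat.{u}} (η : P ⟶ Q)
    [Presheaf.IsLocallyInjective J η] [Presheaf.IsLocallySurjective J η] :
    IsIso ((presheafToSheaf J (Type (u + 1))).map η) := by
  rw [← J.W_iff, J.W_iff_isLocallyBijective]
  exact ⟨inferInstance, inferInstance⟩

variable {N : Type u} [AddCommGroup N] [Module.Free ℤ N] [Module.Finite ℤ N] (Δ : Fan N)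

/-- `X_{𝔽₁}(Δ) ⊗ ℤ` is the functor of points of `X_ℤ(Δ)`. -/
lemma nonempty_baseChangeF1Z_iso : Nonempty ((baseChangeF1Z.obj (toricF1 Δ)).obj ≅
    functorOfPoints (toricScheme Δ)) := by
  let Q : AffPresheaf CommSemiRingCat.{u} :=
    (forget₂ CommSemiRingCat.{u} CommMonCat.{u}).op.op ⋙ (toricF1 Δ).obj
  -- The unit of sheafification over `ℕ`, restricted to rings. Cocontinuity keeps it locally
  -- bijective, so sheafifying in two steps agrees with sheafifying `toricF1OnRings Δ` directly over
  -- `ℤ`.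
  let η : toricF1OnRings Δ ⟶ (forget₂ CommRingCat.{u} CommSemiRingCat.{u}).op.op ⋙
      (sheafify overN.{u}.zariskiTopology Q) :=
    Functor.whiskerLeft (forget₂ CommRingCat.{u} CommSemiRingCat.{u}).op.op
      (toSheafify overN.{u}.zariskiTopology Q)
  have h1 : Presheaf.IsLocallyInjective overZ.{u}.zariskiTopology η :=
    Presheaf.isLocallyInjective_whisker _ overN.{u}.zariskiTopology _ _
  have h2 : Presheaf.IsLocallySurjective overZ.{u}.zariskiTopology η :=
    Presheaf.isLocallySurjective_whisker _ overN.{u}.zariskiTopology _ _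
  have h3 := isIso_presheafToSheaf_map (J := overZ.{u}.zariskiTopology) η
  have h4 := isIso_presheafToSheaf_map (J := overZ.{u}.zariskiTopology) (toricComparison Δ)
  exact ⟨(sheafToPresheaf _ _).mapIso ((asIso ((presheafToSheaf _ _).map η)).symm ≪≫
    asIso ((presheafToSheaf _ _).map (toricComparison Δ))) ≪≫
    (isoSheafify _ (isSheaf_functorOfPoints _)).symm⟩

lemma isScheme_baseChangeF1Z : overZ.{u}.IsScheme (baseChangeF1Z.obj (toricF1 Δ)) := by
  obtain ⟨e⟩ := nonempty_baseChangeF1Z_iso Δ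
  exact ⟨Δ.cones, _, _, (isAffineCovering_toricSchemeChart Δ).comp_iso e.symm⟩

end BaseChange

end F1Toric

end

theorem mainTheorem7 {N : Type u} [AddCommGroup N] [Module.Free ℤ N] [Module.Finite ℤ N]
    (Δ : F1Toric.Fan N) :
    -- for a face `τ` of a cone `σ` of the fan, `U_τ → U_σ` is a Zariski open
    (∀ σ ∈ Δ.cones, ∀ (τ : PointedCone ℝ (F1Toric.RealSpan N)) (h : F1Toric.IsFace τ σ),
      F1Toric.overF1.IsZariskiOpen (F1Toric.coneMonoidMap h.le)) ∧
    -- `R ⇉ X` is a subobject of `X × X` and an equivalence relation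
    (∀ T : (CommMonCat.{u}ᵒᵖ)ᵒᵖ,
      Function.Injective (fun r : (F1Toric.toricR Δ).obj.obj T =>
        ((F1Toric.toricFst Δ).hom.app T r, (F1Toric.toricSnd Δ).hom.app T r)) ∧
      Equivalence (fun x y : (F1Toric.toricX Δ).obj.obj T =>
        ∃ r : (F1Toric.toricR Δ).obj.obj T,
          (F1Toric.toricFst Δ).hom.app T r = x ∧ (F1Toric.toricSnd Δ).hom.app T r = y)) ∧
    -- in the quotient `X / R` the charts `U_σ` and `U_σ'` meet exactly in `U_{σ ∩ σ'}`
    (∀ σ σ' : Δ.cones,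
      IsPullback (F1Toric.toricUMap (inf_le_left : σ.1 ⊓ σ'.1 ≤ σ.1))
        (F1Toric.toricUMap (inf_le_right : σ.1 ⊓ σ'.1 ≤ σ'.1))
        (F1Toric.toricChart Δ σ) (F1Toric.toricChart Δ σ')) ∧
    -- the charts form an affine Zariski covering of `X / R`, which is thus a scheme over `𝔽₁`
    F1Toric.overF1.IsAffineCovering (F1Toric.toricChartRep Δ) ∧
    F1Toric.overF1.IsScheme (F1Toric.toricF1 Δ) ∧
    -- its base change to `ℤ` is a scheme, isomorphic to the usual toric scheme
    F1Toric.overZ.IsScheme (F1Toric.baseChangeF1Z.obj (F1Toric.toricF1 Δ)) ∧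
    Nonempty ((F1Toric.baseChangeF1Z.obj (F1Toric.toricF1 Δ)).obj ≅
      F1Toric.functorOfPoints (F1Toric.toricScheme Δ)) := by
  refine ⟨fun σ hσ τ h => ?_, fun T => ⟨F1Toric.toricFst_toricSnd_injective T,
    F1Toric.toricR_equivalence Δ T⟩, F1Toric.isPullback_toricChart,
    F1Toric.isAffineCovering_toricChartRep Δ, ⟨Δ.cones, _, _,
    F1Toric.isAffineCovering_toricChartRep Δ⟩, F1Toric.isScheme_baseChangeF1Z Δ,
    F1Toric.nonempty_baseChangeF1Z_iso Δ⟩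
  obtain ⟨m, hm⟩ := h.isMonoidAway (Δ.rational σ hσ)
  exact hm.isZariskiOpen
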